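/- \textbf{Model.} On a probability space, shocks arrive at the points $0<T_1<T_2<\cdots$ of a (non-homogeneous) Poisson process with locally integrable intensity $\lambda\ge 0$ on $[0,\infty)$; $N_t=\#\{n: T_n\le t\}$ and $\Lambda(t)=\int_0^t\lambda(x)\,dx$, with $\Lambda(t)>0$ for all $t>0$. The marks $V_n=(V_n^{(1)},V_n^{(2)})$, $n\ge1$, are i.i.d. with values in $[0,\infty)^2$ and independent of $(T_n)_{n\ge1}$; $A_t=(A_t^{(1)},A_t^{(2)})=\sum_{k=1}^{N_t}V_k$, and $\mathcal F_t=\sigma(N_s,A_s: s\le t)$. The process $(G_t)_{t\ge0}$ is nonnegative, nondecreasing and independent of $(T_n,V_n)_{n\ge1}$; $F_{G_t}$ is the distribution function of $G_t$. Let $h\ge0$ be locally integrable on $[0,\infty)$, $H(t)=\int_0^t h(s)\,ds$, let $q:[0,\infty)\to[0,1]$ be measurable, and let $L\in\mathbb R$. Three lifetimes with values in $[0,\infty]$ are considered: \begin{itemize} \item $\tau_1$ (sudden failure of the first component) has conditional hazard rate $h(t)+A^{(1)}_t$: $\mathbb P(\tau_1>t\mid\mathcal F_t)=\exp\bigl(-\int_0^t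 (h(s)+A^{(1)}_s)\,ds\bigr)$ a.s. for all $t\ge0$; \item $\tau_2=\inf\{t\ge0: G_t+A^{(2)}_t>L\}$ (the deterioration of the second component exceeds the threshold $L$); \item $\tau_3$ is the time of the first fatal shock, where, conditionally on the shock environment, a shock at time $u$ is non fatal with probability $q(u)$ independently of the other shocks: $\mathbb P(\tau_3>t\mid\mathcal F_t)=\prod_{i=1}^{N_t}q(T_i)$ a.s. for all $t\ge0$. \end{itemize} For each $t\ge 0$ the events $\{\tau_1>t\},\{\tau_2>t\},\{\tau_3>t\}$ satisfy $\mathbb P(\tau_1>t,\tau_2>t,\tau_3>t\mid\mathcal F_t)=\prod_{i=1}^3\mathbb P(\tau_i>t\mid\mathcal F_t)$ a.s. The system lifetime is $\tau=\min(\tau_1,\tau_2,\tau_3)$. A random variable $Z$ with values in $[0,\infty]$ is New Better than Used (NBU) if $\mathbb P(Z>s+t)\le\mathbb P(Z>s)\,\mathbb P(Z>t)$ for all $s,t\ge0$. \textbf{Theorem.} Assume that the intrinsic lifetimes of both components are NBU, which means that \begin{align*} e^{-H(s+t)}&\le e^{-H(s)}e^{-H(t)}, && s,t\ge0,\\ F_{G_{t+s}}(l)&\le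 F_{G_t}(l)\,F_{G_s}(l), && l,s,t\ge0, \end{align*} where the second condition holds as soon as $(G_t)_{t\ge0}$ is a nonnegative real-valued L\'evy process. Then $\tau$ is NBU if one of the two following conditions is satisfied: \begin{enumerate} \item $q$ is nonincreasing and $\lambda$ is constant; \item $q$ is constant and $\Lambda$ is superadditive: $\Lambda(x+y)\ge\Lambda(x)+\Lambda(y)$ for all $x,y\ge0$. \end{enumerate} -/

import Mathlib

open MeasureTheory ProbabilityTheory Filter Topology
open scoped NNReal ENNReal

noncomputable section

namespace ShockSystem

/-- The cumulated rate `t ↦ ∫₀ᵗ f(x) dx` of a rate function `f`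
(`H` for `f = h`, and `Λ` for `f = λ`). -/
def cumul (f : ℝ → ℝ) (t : ℝ) : ℝ := ∫ x in (0 : ℝ)..t, f x

/-- A lifetime `Z` (possibly infinite) is New Better than Used:
`ℙ(Z > s + t) ≤ ℙ(Z > s) ℙ(Z > t)` for all `s, t ≥ 0`. -/
def IsNBU {Ω : Type*} [MeasurableSpace Ω] (Z : Ω → ℝ≥0∞) (P : Measure Ω) : Prop :=
  ∀ s t : ℝ≥0, P {ω | (s : ℝ≥0∞) + t < Z ω} ≤ P {ω | (s : ℝ≥0∞) < Z ω} * P {ω | (t : ℝ≥0∞) < Z ω}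

/-- NBU property of the intrinsic lifetime of the first component, with hazard rate `h`. -/
def IntrinsicNBU₁ (h : ℝ → ℝ) : Prop :=
  ∀ s t : ℝ, 0 ≤ s → 0 ≤ t →
    Real.exp (-cumul h (s + t)) ≤ Real.exp (-cumul h s) * Real.exp (-cumul h t)

/-- NBU property of the intrinsic lifetime of the second component, with deterioration
process `G`: `F_{G_{t+s}}(l) ≤ F_{G_t}(l) F_{G_s}(l)` for all `l, s, t ≥ 0`. -/
def IntrinsicNBU₂ {Ω : Type*} [MeasurableSpace Ω] (G : ℝ≥0 → Ω → ℝ) (P : Measure Ω) : Prop :=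
  ∀ (l : ℝ) (s t : ℝ≥0), 0 ≤ l →
    cdf (P.map (G (t + s))) l ≤ cdf (P.map (G t)) l * cdf (P.map (G s)) l

/-- A real-valued Lévy process: it starts from `0`, it has independent and stationary increments
and it is continuous in probability. Regularity of the paths is not needed, and not required. -/
structure IsLevyProcess {Ω : Type*} [MeasurableSpace Ω] (G : ℝ≥0 → Ω → ℝ) (P : Measure Ω) :
    Prop where
  measurable : ∀ t, Measurable (G t)
  zero : ∀ᵐ ω ∂P, G 0 ω = 0
  indep_increments : HasIndepIncrements G P
  stationary_increments : ∀ s t, IdentDistrib (fun ω ↦ G (s + t) ω - G s ω) (G t) P P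
  continuous_in_probability : ∀ t, TendstoInMeasure P G (𝓝 t) (G t)

/-- The random objects of the model. Shocks are numbered from `0`:
`T n`, `V n` and `fatal n` refer to the `(n+1)`-st shock. -/
structure Objects (Ω : Type*) where
  /-- arrival times of the shocks -/
  T : ℕ → Ω → ℝ
  /-- increments (of the hazard rate of the first component, of the deterioration of the second
  one) due to the shocks -/
  V : ℕ → Ω → ℝ × ℝ
  /-- intrinsic deterioration of the second component -/
  G : ℝ≥0 → Ω → ℝ
  /-- the event that a shock is fatal to the system -/
  fatal : ℕ → Set Ω
  /-- lifetime of the first component under the external environment -/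
  τ₁ : Ω → ℝ≥0∞

namespace Objects

variable {Ω : Type*} (S : Objects Ω)

/-- The number `N_t` of shocks on `[0, t]`. -/
def N (t : ℝ) (ω : Ω) : ℕ := {n : ℕ | S.T n ω ≤ t}.ncard

/-- The bivariate compound process `A_t = ∑_{k ≤ N_t} V_k`. -/
def A (t : ℝ) (ω : Ω) : ℝ × ℝ := ∑ k ∈ Finset.range (S.N t ω), S.V k ω

/-- The conditional hazard rate of the first component. -/
def X₁ (h : ℝ → ℝ) (t : ℝ) (ω : Ω) : ℝ := h t + (S.A t ω).1

/-- The deterioration level of the second component. -/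
def X₂ (t : ℝ≥0) (ω : Ω) : ℝ := S.G t ω + (S.A t ω).2

/-- The lifetime of the second component: it fails once its deterioration level
exceeds the threshold `L`. -/
def τ₂ (L : ℝ) (ω : Ω) : ℝ≥0∞ := ⨅ (t : ℝ≥0) (_ : L < S.X₂ t ω), (t : ℝ≥0∞)

/-- The time of the first fatal shock. -/
def τ₃ (ω : Ω) : ℝ≥0∞ := ⨅ (n : ℕ) (_ : ω ∈ S.fatal n), ENNReal.ofReal (S.T n ω)

/-- The lifetime of the system. -/
def τ (L : ℝ) (ω : Ω) : ℝ≥0∞ := min (S.τ₁ ω) (min (S.τ₂ L ω) (S.τ₃ ω))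

/-- The history `ℱ_t` of the shocks environment (shocks and increments) up to time `t`. -/
def history (t : ℝ≥0) : MeasurableSpace Ω :=
  ⨆ (s : ℝ≥0) (_ : s ≤ t),
    MeasurableSpace.comap (fun ω ↦ (S.N s ω, S.A s ω)) inferInstance

variable [MeasurableSpace Ω]

/-- The shocks arrive according to a Poisson process with intensity `lam(t) dt`. -/
structure IsPoisson (P : Measure Ω) (lam : ℝ → ℝ) : Prop where
  measurable : ∀ n, Measurable (S.T n)
  pos : ∀ᵐ ω ∂P, ∀ n, 0 < S.T n ω
  strictMono : ∀ᵐ ω ∂P, StrictMono fun n ↦ S.T n ω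
  locally_finite : ∀ᵐ ω ∂P, Tendsto (fun n ↦ S.T n ω) atTop atTop
  indep_increments : HasIndepIncrements (fun (t : ℝ≥0) ω ↦ S.N t ω) P
  law_increments : ∀ s t : ℝ≥0, s ≤ t →
    HasLaw (fun ω ↦ S.N t ω - S.N s ω) (poissonMeasure (cumul lam t - cumul lam s).toNNReal) P

/-- The shock model with intrinsic hazard rate `h`, shock intensity `lam`, probability `q t` for a
shock at time `t` to be non fatal, and failure threshold `L`. -/
structure IsModel (P : Measure Ω) (h lam q : ℝ → ℝ) (L : ℝ) : Prop where
  h_nonneg : ∀ t, 0 ≤ t → 0 ≤ h t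
  h_integrable : ∀ t, 0 ≤ t → IntervalIntegrable h volume 0 t
  lam_nonneg : ∀ t, 0 ≤ t → 0 ≤ lam t
  lam_integrable : ∀ t, 0 ≤ t → IntervalIntegrable lam volume 0 t
  cumul_lam_pos : ∀ t, 0 < t → 0 < cumul lam t
  q_measurable : Measurable q
  q_mem : ∀ t, 0 ≤ t → q t ∈ Set.Icc (0 : ℝ) 1
  /-- shock arrivals -/
  poisson : S.IsPoisson P lam
  /-- increments: nonnegative, i.i.d., independent of the arrival times -/
  V_measurable : ∀ n, Measurable (S.V n)
  V_nonneg : ∀ n, ∀ᵐ ω ∂P, 0 ≤ (S.V n ω).1 ∧ 0 ≤ (S.V n ω).2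
  V_indep : iIndepFun S.V P
  V_identDistrib : ∀ n, IdentDistrib (S.V n) (S.V 0) P P
  V_indep_T : IndepFun (fun ω n ↦ S.V n ω) (fun ω n ↦ S.T n ω) P
  /-- intrinsic deterioration: a nonnegative nondecreasing process, independent of the shocks
  environment -/
  G_measurable : ∀ t, Measurable (S.G t)
  G_nonneg : ∀ᵐ ω ∂P, ∀ t, 0 ≤ S.G t ω
  G_monotone : ∀ᵐ ω ∂P, Monotone fun t ↦ S.G t ω
  G_indep : IndepFun (fun ω t ↦ S.G t ω) (fun ω n ↦ (S.T n ω, S.V n ω)) P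
  /-- `X₁` is the conditional hazard rate of the first component -/
  τ₁_measurable : Measurable S.τ₁
  τ₁_law : ∀ t : ℝ≥0, P⟦{ω | (t : ℝ≥0∞) < S.τ₁ ω} | S.history t⟧ =ᵐ[P]
    fun ω ↦ Real.exp (-∫ s in (0 : ℝ)..t, S.X₁ h s ω)
  /-- given the history, the Bernoulli trials are independent and a shock at time `u` is non fatal
  with probability `q u` -/
  fatal_measurable : ∀ n, MeasurableSet (S.fatal n)
  τ₃_law : ∀ t : ℝ≥0, P⟦{ω | (t : ℝ≥0∞) < S.τ₃ ω} | S.history t⟧ =ᵐ[P]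
    fun ω ↦ ∏ i ∈ Finset.range (S.N t ω), q (S.T i ω)
  /-- conditional independence of the three failure modes given the history -/
  cond_indep : ∀ t : ℝ≥0,
    P⟦{ω | (t : ℝ≥0∞) < S.τ₁ ω ∧ (t : ℝ≥0∞) < S.τ₂ L ω ∧ (t : ℝ≥0∞) < S.τ₃ ω} | S.history t⟧
      =ᵐ[P] P⟦{ω | (t : ℝ≥0∞) < S.τ₁ ω} | S.history t⟧
        * P⟦{ω | (t : ℝ≥0∞) < S.τ₂ L ω} | S.history t⟧
        * P⟦{ω | (t : ℝ≥0∞) < S.τ₃ ω} | S.history t⟧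

end Objects

end ShockSystem

end

/-! Write `K_t(a)` for the probability that `G` is at most `L - a` slightly beyond `t` (`reserve`).
Conditioning on the shocks and integrating out `G` gives `P(τ > t) = e^{-H(t)} E[Φ_t(T, V)]`, where
`Φ_t = exp(-∑ V¹_i (t - T_i)) ∏ q(T_i) K_t(∑ V²_i)` runs over the shocks up to `t` (`survival`,
`measure_lt_τ`). The factor `e^{-H}` is submultiplicative by hypothesis, so only `E[Φ_{s+t}] ≤
E[Φ_s] E[Φ_t]` remains.

Pathwise, `Φ_{s+t}` is at most `Φ_s` times `Φ_t` of the shocks after `s`, seen from `s`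
(`survival_add_le`): the hazard that early shocks add after `s` is dropped, `q(s + u) ≤ q(u)`, and
`K_{s+t}(a + b) ≤ K_s(a) K_t(b)` by the NBU property of `G` (`reserve_add_le`). The expectation of
the product factors, since marks are i.i.d. and independent of the arrivals
(`lintegral_survival_mul`), and Poisson increments are independent (`lintegral_meanSurvival_mul`).

It remains to compare the shifted shocks with the original ones. The process `N_{s+u} - N_s` has the
law of `N_{v(u)}` whenever `Λ(v(u)) = Λ(s+u) - Λ(s)` (`identDistrib_timeChange`). For constant
intensity, `v` is the identity. For superadditive `Λ`, one can take `v(u) ≥ u`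
(`exists_timeChange`), so the time-changed shocks come earlier; for constant `q` this can only lower
`Φ_t` (`survival_le_survival`). -/

namespace ShockSystem

/-! ### Nonnegative Lévy processes -/

section Levy

variable {Ω : Type*} [MeasurableSpace Ω] {P : Measure Ω} [IsProbabilityMeasure P]

/-- A nonnegative Lévy process has the NBU property of the deterioration levels. -/
theorem IsLevyProcess.intrinsicNBU₂ {G : ℝ≥0 → Ω → ℝ} (hG : IsLevyProcess G P)
    (h0 : ∀ t, ∀ᵐ ω ∂P, 0 ≤ G t ω) : IntrinsicNBU₂ G P := by
  intro l s t _
  have hm := hG.measurable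
  have : ∀ u, IsProbabilityMeasure (P.map (G u)) := fun u ↦
    Measure.isProbabilityMeasure_map (hm u).aemeasurable
  have hincr : ∀ᵐ ω ∂P, 0 ≤ G (t + s) ω - G t ω :=
    (hG.stationary_increments t s).symm.ae_snd (p := fun x ↦ 0 ≤ x) measurableSet_Ici (h0 s)
  have hindep : G t ⟂ᵢ[P] (G (t + s) - G t) :=
    hG.indep_increments.indepFun_eval_sub zero_le (by simp) hG.zero
  -- `G (t + s)` is the sum of two a.s. nonnegative independent terms, so it is at most `l` only if
  -- both terms are.
  have key : P (G (t + s) ⁻¹' Set.Iic l) ≤ P (G t ⁻¹' Set.Iic l) * P (G s ⁻¹' Set.Iic l) := by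
    have h1 : P (G s ⁻¹' Set.Iic l) = P ((G (t + s) - G t) ⁻¹' Set.Iic l) :=
      ((hG.stationary_increments t s).measure_mem_eq measurableSet_Iic).symm
    rw [h1, ← hindep.measure_inter_preimage_eq_mul _ _ measurableSet_Iic measurableSet_Iic]
    refine measure_mono_ae ?_
    filter_upwards [hincr, h0 t] with ω h2 h3 h4
    have h4' : G (t + s) ω ≤ l := h4
    exact ⟨show G t ω ≤ l by linarith, show G (t + s) ω - G t ω ≤ l by linarith⟩
  simp only [cdf_eq_real, measureReal_def, Measure.map_apply (hm _) measurableSet_Iic]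
  rw [← ENNReal.toReal_mul]
  exact ENNReal.toReal_mono (by finiteness) key

end Levy

/-! ### Counting processes with independent increments -/

section Processes

variable {Ω : Type*} [MeasurableSpace Ω] {P : Measure Ω} [IsProbabilityMeasure P]

/-- The first `m` terms of an independent sequence are independent of the following ones. -/
theorem indepFun_initial_tail {E : Type*} [MeasurableSpace E] {X : ℕ → Ω → E}
    (hm : ∀ i, Measurable (X i)) (h : iIndepFun X P) (m : ℕ) :
    (fun ω (i : Finset.range m) ↦ X i ω) ⟂ᵢ[P] (fun ω i ↦ X (m + i) ω) := by
  refine IndepFun.indepFun_process (by fun_prop) (fun i ↦ hm _) fun J ↦ ?_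
  have hd : Disjoint (Finset.range m) (J.image (m + ·)) := by
    rw [Finset.disjoint_left]
    intro a ha hb
    simp only [Finset.mem_range, Finset.mem_image] at ha hb
    omega
  have := h.indepFun_finset _ _ hd hm
  let g : ((i : J.image (m + ·)) → E) → (J → E) :=
    fun d i ↦ d ⟨m + i, Finset.mem_image_of_mem _ i.2⟩
  exact this.comp (φ := id) (ψ := g) measurable_id (by fun_prop)

/-- A finite set of times is covered by a monotone sequence starting from `0`. -/
theorem exists_monotone_seq_cover (I : Finset ℝ≥0) :
    ∃ t : ℕ → ℝ≥0, Monotone t ∧ t 0 = 0 ∧ ∀ x ∈ I, ∃ n, t n = x := by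
  classical
  set J := insert 0 I with hJ
  obtain ⟨n, hn⟩ : ∃ n, J.card = n + 1 :=
    Nat.exists_eq_succ_of_ne_zero (Finset.card_ne_zero.2 ⟨0, Finset.mem_insert_self _ _⟩)
  let e := J.orderEmbOfFin hn
  -- The sorted times are continued by their maximum, hence the cap `min k n`.
  have hmono : Monotone fun k : ℕ ↦ e ⟨min k n, by omega⟩ := fun a b hab ↦
    e.monotone (by simp only [Fin.mk_le_mk]; omega)
  have hcov : ∀ x ∈ J, ∃ k : ℕ, e ⟨min k n, by omega⟩ = x := by
    intro x hx
    have : x ∈ Set.range e := by rw [Finset.range_orderEmbOfFin]; exact hx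
    obtain ⟨i, rfl⟩ := this
    exact ⟨i, by congr 1; ext; simp; omega⟩
  refine ⟨_, hmono, ?_, fun x hx ↦ hcov x (Finset.mem_insert_of_mem hx)⟩
  obtain ⟨k, hk⟩ := hcov 0 (Finset.mem_insert_self _ _)
  exact le_antisymm ((hmono (Nat.zero_le k)).trans hk.le) zero_le

theorem sum_increments_eq {f : ℕ → ℕ} (hf : Monotone f) {m n : ℕ} (hmn : m ≤ n) :
    f n - f m = ∑ j ∈ Finset.range (n - m), (f (m + j + 1) - f (m + j)) := by
  obtain ⟨k, rfl⟩ := Nat.exists_eq_add_of_le hmn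
  rw [Nat.add_sub_cancel_left]
  clear hmn
  induction k with
  | zero => simp
  | succ k ih =>
    rw [Finset.sum_range_succ, ← ih]
    have h1 := hf (Nat.le_add_right m k)
    have h2 := hf (Nat.le_add_right (m + k) 1)
    rw [← add_assoc]
    omega

/-- The law of a counting process with independent increments is determined by the laws of
its increments. -/
theorem identDistrib_of_indepIncrements {X Y : ℝ≥0 → Ω → ℕ} (hXm : ∀ t, Measurable (X t))
    (hYm : ∀ t, Measurable (Y t)) (hX : HasIndepIncrements X P) (hY : HasIndepIncrements Y P)
    (hX0 : ∀ᵐ ω ∂P, X 0 ω = 0) (hY0 : ∀ᵐ ω ∂P, Y 0 ω = 0)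
    (hXmono : ∀ᵐ ω ∂P, Monotone fun t ↦ X t ω) (hYmono : ∀ᵐ ω ∂P, Monotone fun t ↦ Y t ω)
    (h : ∀ a b, a ≤ b →
      IdentDistrib (fun ω ↦ X b ω - X a ω) (fun ω ↦ Y b ω - Y a ω) P P) :
    IdentDistrib (fun ω t ↦ X t ω) (fun ω t ↦ Y t ω) P P := by
  have hXm' : Measurable fun ω t ↦ X t ω := measurable_pi_lambda _ hXm
  have hYm' : Measurable fun ω t ↦ Y t ω := measurable_pi_lambda _ hYm
  rw [identDistrib_iff_forall_finset_identDistrib hXm'.aemeasurable hYm'.aemeasurable]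
  intro I
  obtain ⟨t, ht, ht0, hcov⟩ := exists_monotone_seq_cover I
  choose! k hk using hcov
  let g : (ℕ → ℕ) → (I → ℕ) := fun d i ↦ ∑ j ∈ Finset.range (k i), d j
  have hg : Measurable g := by fun_prop
  -- Starting from `0`, a path is the partial sum of its increments along the grid, so one
  -- measurable map `g` recovers the marginals of both processes.
  have key : ∀ Z : ℝ≥0 → Ω → ℕ, (∀ᵐ ω ∂P, Z 0 ω = 0) → (∀ᵐ ω ∂P, Monotone fun t ↦ Z t ω) →
      (fun ω ↦ I.restrict (Z · ω)) =ᵐ[P] g ∘ fun ω j ↦ Z (t (j + 1)) ω - Z (t j) ω := by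
    intro Z h0 hmono
    filter_upwards [h0, hmono] with ω h1 h2
    ext i
    have := sum_increments_eq (h2.comp ht) (Nat.zero_le (k i))
    simp only [Function.comp_apply, hk i i.2, ht0, h1, zero_add, Nat.sub_zero] at this
    simp [g, this, Finset.restrict]
  have hD : IdentDistrib (fun ω j ↦ X (t (j + 1)) ω - X (t j) ω)
      (fun ω j ↦ Y (t (j + 1)) ω - Y (t j) ω) P P := by
    refine ⟨by fun_prop, by fun_prop, ?_⟩
    rw [iIndepFun.map_fun_eq_infinitePi_map (fun j ↦ by fun_prop) (hX.nat ht),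
      iIndepFun.map_fun_eq_infinitePi_map (fun j ↦ by fun_prop) (hY.nat ht)]
    congr 1
    ext1 j
    exact (h _ _ (ht (Nat.le_succ j))).map_eq
  have h1 := hD.comp hg
  exact ((IdentDistrib.of_ae_eq (measurable_pi_lambda _ fun _ ↦ by fun_prop).aemeasurable (key X hX0 hXmono)).trans h1).trans
    (IdentDistrib.of_ae_eq (measurable_pi_lambda _ fun _ ↦ by fun_prop).aemeasurable (key Y hY0 hYmono)).symm

/-- The past of a counting process with independent increments is independent of its
future increments. -/
theorem indepFun_past_future {X : ℝ≥0 → Ω → ℕ} (hXm : ∀ t, Measurable (X t))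
    (hX : HasIndepIncrements X P) (hX0 : ∀ᵐ ω ∂P, X 0 ω = 0)
    (hXmono : ∀ᵐ ω ∂P, Monotone fun t ↦ X t ω) (s : ℝ≥0) :
    (fun ω t ↦ X (min t s) ω) ⟂ᵢ[P] (fun ω t ↦ X (s + t) ω - X s ω) := by
  classical
  refine IndepFun.process_indepFun_process (X := fun t ω ↦ X (min t s) ω)
    (Y := fun t ω ↦ X (s + t) ω - X s ω) (fun t ↦ hXm _) (fun t ↦ by fun_prop) fun I J ↦ ?_
  obtain ⟨t, ht, ht0, hcov⟩ := exists_monotone_seq_cover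
    (insert s (I.image (min · s) ∪ J.image (s + ·)))
  obtain ⟨m, hm⟩ := hcov s (by simp)
  -- The grid may repeat values, so an index found for a past time can exceed `m`; capping it at `m`
  -- leaves the time unchanged. Future times are treated symmetrically.
  have hI : ∀ u ∈ I, ∃ n, n ≤ m ∧ t n = min u s := by
    intro u hu
    obtain ⟨n, hn⟩ := hcov (min u s) (by
      simp only [Finset.mem_insert, Finset.mem_union, Finset.mem_image]
      exact Or.inr (Or.inl ⟨u, hu, rfl⟩))
    exact ⟨min n m, min_le_right _ _, by rw [ht.map_min, hn, hm]; simp⟩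
  have hJ : ∀ u ∈ J, ∃ n, m ≤ n ∧ t n = s + u := by
    intro u hu
    obtain ⟨n, hn⟩ := hcov (s + u) (by
      simp only [Finset.mem_insert, Finset.mem_union, Finset.mem_image]
      exact Or.inr (Or.inr ⟨u, hu, rfl⟩))
    exact ⟨max n m, le_max_right _ _, by rw [ht.map_max, hn, hm]; simp⟩
  choose! k hk hk' using hI
  choose! k₂ hk₂ hk₂' using hJ
  have hind := indepFun_initial_tail (X := fun j ω ↦ X (t (j + 1)) ω - X (t j) ω)
    (fun j ↦ by fun_prop) (hX.nat ht) m
  let φ : (Finset.range m → ℕ) → (I → ℕ) := fun d i ↦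
    ∑ j ∈ (Finset.range m).attach with j.1 < k i, d j
  let ψ : (ℕ → ℕ) → (J → ℕ) := fun d i ↦ ∑ j ∈ Finset.range (k₂ i - m), d j
  refine (hind.comp (φ := φ) (ψ := ψ) (by fun_prop) (by fun_prop)).congr ?_ ?_
  · filter_upwards [hX0, hXmono] with ω h1 h2
    ext i
    have := sum_increments_eq (h2.comp ht) (Nat.zero_le (k i))
    simp only [Function.comp_apply, hk' i i.2, ht0, h1, zero_add, Nat.sub_zero] at this
    simp only [φ, Function.comp_apply, this]
    rw [Finset.sum_filter, Finset.sum_attach (Finset.range m)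
      (fun j ↦ if j < k i then X (t (j + 1)) ω - X (t j) ω else 0), ← Finset.sum_filter]
    congr 1
    ext j
    have := hk i i.2
    simp; omega
  · filter_upwards [hXmono] with ω h2
    ext i
    have := sum_increments_eq (h2.comp ht) (hk₂ i i.2)
    simp only [Function.comp_apply, hk₂' i i.2, hm] at this
    simp only [ψ, Function.comp_apply, this]

end Processes

/-! ### Point sequences and their counting paths -/

section Counting

/-- The number of terms of a sequence of points that are at most `t`. -/
noncomputable def count (x : ℕ → ℝ) (t : ℝ) : ℕ := {n : ℕ | x n ≤ t}.ncard

/-- A nonnegative nondecreasing sequence of points without finite accumulation point. -/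
structure IsPointSeq (x : ℕ → ℝ) : Prop where
  nonneg : ∀ i, 0 ≤ x i
  mono : Monotone x
  finite : ∀ t, {i | x i ≤ t}.Finite

/-- By monotonicity the indices of points up to `t` form an initial segment. This duality between
points and counts carries the rest of the section. -/
theorem IsPointSeq.lt_count_iff {x : ℕ → ℝ} (hx : IsPointSeq x) {t : ℝ} {i : ℕ} :
    i < count x t ↔ x i ≤ t := by
  classical
  have hex : ∃ k, ¬ x k ≤ t := by
    by_contra! h
    exact Set.infinite_univ ((hx.finite t).subset fun i _ ↦ h i)
  have hset : {n | x n ≤ t} = ↑(Finset.range (Nat.find hex)) := by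
    ext n
    simp only [Set.mem_ofPred_eq, Finset.coe_range, Set.mem_Iio, Nat.lt_find_iff, not_not]
    exact ⟨fun h m hm ↦ (hx.mono hm).trans h, fun h ↦ h n le_rfl⟩
  have hc : count x t = Nat.find hex := by
    rw [count, hset, Set.ncard_coe_finset, Finset.card_range]
  rw [hc]
  have : i ∈ {n | x n ≤ t} ↔ i < Nat.find hex := by rw [hset]; simp
  exact this.symm

theorem IsPointSeq.count_mono {x : ℕ → ℝ} (hx : IsPointSeq x) : Monotone (count x) := by
  intro s t hst
  exact Set.ncard_le_ncard (fun i (hi : x i ≤ s) ↦ hi.trans hst) (hx.finite t)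

theorem count_le_count_of_le {x y : ℕ → ℝ} (hx : IsPointSeq x) (h : ∀ i, x i ≤ y i) (t : ℝ) :
    count y t ≤ count x t :=
  Set.ncard_le_ncard (fun i (hi : y i ≤ t) ↦ (h i).trans hi) (hx.finite t)

theorem measurable_count (t : ℝ) : Measurable fun x ↦ count x t := by
  -- The two sides also agree when infinitely many points lie below `t`: `ncard` is then `0`, and so
  -- is `⊤.toReal`.
  have h : ∀ x : ℕ → ℝ,
      count x t = ⌊(∑' i, if x i ≤ t then (1 : ℝ≥0∞) else 0).toReal⌋₊ := by
    intro x
    have h1 : (∑' i, if x i ≤ t then (1 : ℝ≥0∞) else 0) = ({i | x i ≤ t}.encard : ℝ≥0∞) := by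
      rw [← ENNReal.tsum_set_one, tsum_subtype {i | x i ≤ t} (fun _ ↦ (1 : ℝ≥0∞))]
      simp [Set.indicator_apply]
    rw [h1]
    rcases Set.finite_or_infinite {i | x i ≤ t} with hf | hf
    · rw [← hf.cast_ncard_eq]
      simp [count]
    · simp [count, hf.ncard, hf.encard_eq]
  simp_rw [h]
  refine Nat.measurable_floor.comp (Measurable.ennreal_toReal ?_)
  refine Measurable.tsum fun i ↦ Measurable.ite ?_ measurable_const measurable_const
  exact measurableSet_le (measurable_pi_apply i) measurable_const

/-- The points of `x` after time `s`, seen from time `s`. -/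
noncomputable def shiftPoints (s : ℝ) (x : ℕ → ℝ) (i : ℕ) : ℝ := x (count x s + i) - s

theorem IsPointSeq.shiftPoints {x : ℕ → ℝ} (hx : IsPointSeq x) (s : ℝ) :
    IsPointSeq (shiftPoints s x) where
  nonneg i := by
    have : ¬ x (count x s + i) ≤ s := by rw [← hx.lt_count_iff]; omega
    simp only [ShockSystem.shiftPoints]; linarith
  mono i j hij := by
    have := hx.mono (Nat.add_le_add_left hij (count x s))
    simp only [ShockSystem.shiftPoints]; linarith
  finite t := by
    have := (hx.finite (t + s)).preimage (add_right_injective (count x s)).injOn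
    refine this.subset fun i hi ↦ ?_
    simp only [ShockSystem.shiftPoints, Set.mem_ofPred_eq, Set.mem_preimage] at hi ⊢
    linarith

theorem IsPointSeq.count_add {x : ℕ → ℝ} (hx : IsPointSeq x) (s : ℝ) {t : ℝ} (ht : 0 ≤ t) :
    count x (s + t) = count x s + count (ShockSystem.shiftPoints s x) t := by
  have hle := hx.count_mono (show s ≤ s + t by linarith)
  have key : ∀ i, i < count (ShockSystem.shiftPoints s x) t ↔ count x s + i < count x (s + t) := by
    intro i
    rw [(hx.shiftPoints s).lt_count_iff, hx.lt_count_iff, ShockSystem.shiftPoints]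
    constructor <;> intro h <;> linarith
  refine le_antisymm ?_ ?_
  · by_contra! h
    have := (key (count (ShockSystem.shiftPoints s x) t)).2 h
    omega
  · by_contra! h
    have := (key (count x (s + t) - count x s)).1 (by omega)
    omega

/-- The points of the counting path `M`, as extended nonnegative numbers. -/
noncomputable def pathPointsE (M : ℝ≥0 → ℕ) (i : ℕ) : ℝ≥0∞ :=
  ⨅ r : ℚ, if i < M (Real.toNNReal r) then ((Real.toNNReal r : ℝ≥0) : ℝ≥0∞) else ⊤

/-- The points of the counting path `M`. -/
noncomputable def pathPoints (M : ℝ≥0 → ℕ) (i : ℕ) : ℝ := (pathPointsE M i).toReal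

theorem measurable_pathPoints : Measurable pathPoints := by
  refine measurable_pi_lambda _ fun i ↦ Measurable.ennreal_toReal ?_
  refine Measurable.iInf fun r ↦ Measurable.ite ?_ measurable_const measurable_const
  exact measurableSet_lt measurable_const (measurable_pi_apply _)

/-- Density of the rationals makes a countable infimum sufficient, which keeps the recovery of
points from paths measurable. Negative rationals count as time `0`, which is harmless. -/
theorem pathPointsE_eq {M : ℝ≥0 → ℕ} {a : ℝ} {i : ℕ} (h : ∀ r : ℝ≥0, i < M r ↔ a ≤ r) :
    pathPointsE M i = ENNReal.ofReal a := by
  refine le_antisymm (le_of_forall_gt fun b hb ↦ ?_) (le_iInf fun r ↦ ?_)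
  · obtain ⟨r, -, hr1, hr2⟩ := ENNReal.lt_iff_exists_rat_btwn.1 hb
    refine lt_of_le_of_lt (iInf_le _ r) ?_
    rw [if_pos]
    · exact hr2
    · rw [h]
      have : a ≤ ((Real.toNNReal r : ℝ≥0) : ℝ≥0∞).toReal :=
        (ENNReal.ofReal_le_iff_le_toReal ENNReal.coe_ne_top).1 hr1.le
      simpa using this
  · split_ifs with hr
    · rw [h] at hr
      exact ENNReal.ofReal_le_of_le_toReal (by simpa using hr)
    · exact le_top

theorem pathPoints_eq {M : ℝ≥0 → ℕ} {x : ℕ → ℝ} (h0 : ∀ i, 0 ≤ x i)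
    (h : ∀ i (r : ℝ≥0), i < M r ↔ x i ≤ r) : pathPoints M = x := by
  ext i
  rw [pathPoints, pathPointsE_eq (h i), ENNReal.toReal_ofReal (h0 i)]

theorem IsPointSeq.pathPoints_count {x : ℕ → ℝ} (hx : IsPointSeq x) :
    pathPoints (fun u ↦ count x u) = x :=
  pathPoints_eq hx.nonneg fun _ _ ↦ hx.lt_count_iff

theorem IsPointSeq.pathPoints_shift {x : ℕ → ℝ} (hx : IsPointSeq x) (s : ℝ≥0) :
    pathPoints (fun u ↦ count x (s + u : ℝ≥0) - count x s) = ShockSystem.shiftPoints s x := by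
  refine pathPoints_eq (hx.shiftPoints s).nonneg fun i r ↦ ?_
  rw [NNReal.coe_add, hx.count_add s r.coe_nonneg, Nat.add_sub_cancel_left]
  exact (hx.shiftPoints s).lt_count_iff

/-- A counting path that dominates another one has earlier points. -/
theorem IsPointSeq.pathPoints_timeChange {x : ℕ → ℝ} (hx : IsPointSeq x) {v : ℝ≥0 → ℝ≥0}
    (hv : Monotone v) (hle : ∀ u, u ≤ v u) :
    IsPointSeq (pathPoints fun u ↦ count x (v u)) ∧
      ∀ i, pathPoints (fun u ↦ count x (v u)) i ≤ x i := by
  set M : ℝ≥0 → ℕ := fun u ↦ count x (v u) with hM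
  have hE : ∀ i, pathPointsE M i ≤ ENNReal.ofReal (x i) := by
    intro i
    -- Once `x i` is written as the infimum attached to its own counting path, the two infima
    -- compare term by term.
    rw [← pathPointsE_eq (M := fun u ↦ count x u) (fun _ ↦ hx.lt_count_iff)]
    refine iInf_mono fun r ↦ ?_
    by_cases h : i < count x (Real.toNNReal r : ℝ≥0)
    · rw [if_pos h, if_pos]
      exact h.trans_le (hx.count_mono (NNReal.coe_le_coe.2 (hle _)))
    · rw [if_neg h]; exact le_top
  have hfin : ∀ i, pathPointsE M i ≠ ⊤ := fun i ↦ ((hE i).trans_lt ENNReal.ofReal_lt_top).ne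
  refine ⟨⟨fun i ↦ ENNReal.toReal_nonneg, fun i j hij ↦ ?_, fun t ↦ ?_⟩, fun i ↦ ?_⟩
  · refine ENNReal.toReal_mono (hfin j) (iInf_mono fun r ↦ ?_)
    by_cases h : j < M (Real.toNNReal r)
    · rw [if_pos h, if_pos (hij.trans_lt h)]
    · rw [if_neg h]; exact le_top
  -- The infimum defining a point need not be attained, since the time-changed path need not be
  -- right-continuous; the margin `1` provides an actual time `r` with `i < M r`.
  · refine (Set.finite_Iio (M (Real.toNNReal (t + 1)))).subset fun i (hi : _ ≤ t) ↦ ?_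
    have h1 : pathPointsE M i < ENNReal.ofReal (t + 1) := by
      rw [ENNReal.lt_ofReal_iff_toReal_lt (hfin i)]
      exact lt_of_le_of_lt hi (by linarith)
    obtain ⟨r, hr⟩ := iInf_lt_iff.1 h1
    by_cases h : i < M (Real.toNNReal r)
    · rw [if_pos h] at hr
      refine h.trans_le (hx.count_mono (NNReal.coe_le_coe.2 (hv ?_)))
      exact (ENNReal.coe_lt_coe.1 hr).le
    · rw [if_neg h] at hr
      exact absurd hr not_top_lt
  · exact ENNReal.toReal_le_of_le_ofReal (hx.nonneg i) (hE i)

end Counting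

/-! ### The conditional survival functional -/

section Functional

/-- The conditional survival probability at time `t`, up to the intrinsic factor of the first
component, when the shocks occur at the points `x` with marks `v`; `K a` is the survival
probability of the second component when the shocks have contributed `a` to its deterioration. -/
noncomputable def survival (q : ℝ → ℝ) (K : ℝ → ℝ≥0∞) (t : ℝ) (x : ℕ → ℝ) (v : ℕ → ℝ × ℝ) :
    ℝ≥0∞ :=
  ENNReal.ofReal (Real.exp (-∑ i ∈ Finset.range (count x t), (v i).1 * (t - x i))) *
    (∏ i ∈ Finset.range (count x t), ENNReal.ofReal (q (x i))) *
    K (∑ i ∈ Finset.range (count x t), (v i).2)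

/-- Handles sums and products with a random number of terms: countability of `ℕ` gives joint
measurability in the index. -/
theorem measurable_of_index {Z E : Type*} [MeasurableSpace Z] [MeasurableSpace E]
    {f : ℕ → Z → E} (hf : ∀ n, Measurable (f n)) {c : Z → ℕ} (hc : Measurable c) :
    Measurable fun z ↦ f (c z) z :=
  (measurable_from_prod_countable_right (f := fun p : ℕ × Z ↦ f p.1 p.2) hf).comp
    (hc.prodMk measurable_id)

theorem measurable_survival {q : ℝ → ℝ} (hq : Measurable q) {K : ℝ → ℝ≥0∞} (hK : Measurable K)
    (t : ℝ) : Measurable fun p : (ℕ → ℝ) × (ℕ → ℝ × ℝ) ↦ survival q K t p.1 p.2 := by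
  have hc : Measurable fun p : (ℕ → ℝ) × (ℕ → ℝ × ℝ) ↦ count p.1 t :=
    (measurable_count t).comp measurable_fst
  refine Measurable.mul (Measurable.mul (ENNReal.measurable_ofReal.comp
    (Real.measurable_exp.comp (Measurable.neg ?_))) ?_) (hK.comp ?_)
  · exact measurable_of_index
      (f := fun n p ↦ ∑ i ∈ Finset.range n, (p.2 i).1 * (t - p.1 i)) (fun n ↦ by fun_prop) hc
  · exact measurable_of_index
      (f := fun n p ↦ ∏ i ∈ Finset.range n, ENNReal.ofReal (q (p.1 i))) (fun n ↦ by fun_prop) hc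
  · exact measurable_of_index
      (f := fun n p ↦ ∑ i ∈ Finset.range n, (p.2 i).2) (fun n ↦ by fun_prop) hc

theorem measurable_survival_comp {q : ℝ → ℝ} (hq : Measurable q) {K : ℝ → ℝ≥0∞}
    (hK : Measurable K) (t : ℝ) {Z : Type*} [MeasurableSpace Z] {x : Z → ℕ → ℝ}
    {v : Z → ℕ → ℝ × ℝ} (hx : Measurable x) (hv : Measurable v) :
    Measurable fun z ↦ survival q K t (x z) (v z) := by
  have h := (measurable_survival hq hK t).comp (hx.prodMk hv)
  exact h

/-- Only points and marks counted up to `t` matter; this lets the past be separated from the future.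
-/
theorem survival_congr {q : ℝ → ℝ} {K : ℝ → ℝ≥0∞} {t : ℝ} {x y : ℕ → ℝ} {v w : ℕ → ℝ × ℝ}
    (hc : count y t = count x t) (h : ∀ i < count x t, y i = x i)
    (hv : ∀ i < count x t, w i = v i) : survival q K t y w = survival q K t x v := by
  have h1 : ∑ i ∈ Finset.range (count x t), (w i).1 * (t - y i) =
      ∑ i ∈ Finset.range (count x t), (v i).1 * (t - x i) :=
    Finset.sum_congr rfl fun i hi ↦ by
      rw [h i (Finset.mem_range.1 hi), hv i (Finset.mem_range.1 hi)]
  have h2 : ∏ i ∈ Finset.range (count x t), ENNReal.ofReal (q (y i)) =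
      ∏ i ∈ Finset.range (count x t), ENNReal.ofReal (q (x i)) :=
    Finset.prod_congr rfl fun i hi ↦ by rw [h i (Finset.mem_range.1 hi)]
  have h3 : ∑ i ∈ Finset.range (count x t), (w i).2 =
      ∑ i ∈ Finset.range (count x t), (v i).2 :=
    Finset.sum_congr rfl fun i hi ↦ by rw [hv i (Finset.mem_range.1 hi)]
  rw [survival, hc, h1, h2, h3, survival]

/-- Delaying the shocks improves survival. -/
theorem survival_le_survival {q : ℝ → ℝ} {K : ℝ → ℝ≥0∞} (hK : Antitone K) {t : ℝ}
    {x y : ℕ → ℝ} {v : ℕ → ℝ × ℝ} (hx : IsPointSeq x)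
    (hxy : ∀ i, x i ≤ y i) (hv : ∀ i, 0 ≤ (v i).1 ∧ 0 ≤ (v i).2)
    (hq : ∀ i, q (x i) ≤ q (y i)) (hq1 : ∀ i, q (x i) ≤ 1) :
    survival q K t x v ≤ survival q K t y v := by
  have hc := count_le_count_of_le hx hxy t
  have hsub : Finset.range (count y t) ⊆ Finset.range (count x t) :=
    Finset.range_subset_range.2 hc
  refine mul_le_mul' (mul_le_mul' ?_ ?_) (hK ?_)
  · refine ENNReal.ofReal_le_ofReal (Real.exp_le_exp.2 (neg_le_neg ?_))
    calc ∑ i ∈ Finset.range (count y t), (v i).1 * (t - y i)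
        ≤ ∑ i ∈ Finset.range (count y t), (v i).1 * (t - x i) :=
          Finset.sum_le_sum fun i _ ↦ mul_le_mul_of_nonneg_left (by linarith [hxy i]) (hv i).1
      _ ≤ _ := Finset.sum_le_sum_of_subset_of_nonneg hsub fun i hi _ ↦ by
          rw [Finset.mem_range, hx.lt_count_iff] at hi
          exact mul_nonneg (hv i).1 (by linarith)
  · calc ∏ i ∈ Finset.range (count x t), ENNReal.ofReal (q (x i))
        ≤ ∏ i ∈ Finset.range (count y t), ENNReal.ofReal (q (x i)) :=
          Finset.prod_le_prod_of_subset_of_le_one' hsub fun i _ _ ↦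
            ENNReal.ofReal_le_one.2 (hq1 i)
      _ ≤ _ := Finset.prod_le_prod' fun i _ ↦ ENNReal.ofReal_le_ofReal (hq i)
  · exact Finset.sum_le_sum_of_subset_of_nonneg hsub fun i _ _ ↦ (hv i).2

/-- Restarting the deterioration at time `s` improves survival. -/
theorem survival_add_le {q : ℝ → ℝ} {K K₁ K₂ : ℝ → ℝ≥0∞} {s t : ℝ} (ht : 0 ≤ t)
    {x : ℕ → ℝ} {v : ℕ → ℝ × ℝ} (hx : IsPointSeq x) (hv : ∀ i, 0 ≤ (v i).1 ∧ 0 ≤ (v i).2)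
    (hq : ∀ u, 0 ≤ u → q (s + u) ≤ q u)
    (hK : ∀ a b, 0 ≤ a → 0 ≤ b → K (a + b) ≤ K₁ a * K₂ b) :
    survival q K (s + t) x v ≤ survival q K₁ s x v *
      survival q K₂ t (shiftPoints s x) (fun i ↦ v (count x s + i)) := by
  simp only [survival, hx.count_add s ht, Finset.sum_range_add, Finset.prod_range_add]
  set n := count x s
  set m := count (shiftPoints s x) t
  have h1 : ENNReal.ofReal (Real.exp (-(∑ i ∈ Finset.range n, (v i).1 * (s + t - x i) +
        ∑ i ∈ Finset.range m, (v (n + i)).1 * (s + t - x (n + i))))) ≤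
      ENNReal.ofReal (Real.exp (-∑ i ∈ Finset.range n, (v i).1 * (s - x i))) *
      ENNReal.ofReal (Real.exp (-∑ i ∈ Finset.range m,
        (v (n + i)).1 * (t - shiftPoints s x i))) := by
    rw [← ENNReal.ofReal_mul (Real.exp_nonneg _), ← Real.exp_add]
    refine ENNReal.ofReal_le_ofReal (Real.exp_le_exp.2 ?_)
    rw [← neg_add]
    -- Early shocks lose the hazard they contribute after `s`; for later shocks the elapsed time is
    -- the same from either origin.
    refine neg_le_neg (add_le_add ?_ (le_of_eq ?_))
    · exact Finset.sum_le_sum fun i _ ↦ mul_le_mul_of_nonneg_left (by linarith) (hv i).1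
    · refine Finset.sum_congr rfl fun i _ ↦ ?_
      simp only [shiftPoints, n]; ring
  have h2 : ∏ i ∈ Finset.range m, ENNReal.ofReal (q (x (n + i))) ≤
      ∏ i ∈ Finset.range m, ENNReal.ofReal (q (shiftPoints s x i)) := by
    refine Finset.prod_le_prod' fun i _ ↦ ENNReal.ofReal_le_ofReal ?_
    have := hq _ ((hx.shiftPoints s).nonneg i)
    simpa [shiftPoints] using this
  have h3 := hK _ _ (Finset.sum_nonneg fun i (_ : i ∈ Finset.range n) ↦ (hv i).2)
    (Finset.sum_nonneg fun i (_ : i ∈ Finset.range m) ↦ (hv (n + i)).2)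
  refine (mul_le_mul' (mul_le_mul' h1 (mul_le_mul' le_rfl h2)) h3).trans (le_of_eq ?_)
  ring

end Functional

/-! ### Cumulated rates and the time change -/

section Cumul

variable {f : ℝ → ℝ}

theorem cumul_sub_cumul (hi : ∀ t, 0 ≤ t → IntervalIntegrable f volume 0 t) {a b : ℝ}
    (ha : 0 ≤ a) (hb : 0 ≤ b) : cumul f b - cumul f a = ∫ x in a..b, f x :=
  intervalIntegral.integral_interval_sub_left (hi b hb) (hi a ha)

theorem cumul_mono (h0 : ∀ t, 0 ≤ t → 0 ≤ f t)
    (hi : ∀ t, 0 ≤ t → IntervalIntegrable f volume 0 t) {a b : ℝ} (ha : 0 ≤ a) (hab : a ≤ b) :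
    cumul f a ≤ cumul f b := by
  have h1 := cumul_sub_cumul hi ha (ha.trans hab)
  have h2 : 0 ≤ ∫ x in a..b, f x :=
    intervalIntegral.integral_nonneg hab fun u hu ↦ h0 u (ha.trans hu.1)
  linarith

theorem continuousOn_cumul (hi : ∀ t, 0 ≤ t → IntervalIntegrable f volume 0 t) {b : ℝ}
    (hb : 0 ≤ b) : ContinuousOn (cumul f) (Set.Icc 0 b) := by
  have := intervalIntegral.continuousOn_primitive_interval' (hi b hb) (Set.left_mem_uIcc)
  rwa [Set.uIcc_of_le hb] at this

theorem cumul_zero : cumul f 0 = 0 := intervalIntegral.integral_same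

/-- The time change that turns the intensity seen from time `s` into the intensity seen from time
`0`, when the cumulated intensity is superadditive. -/
theorem exists_timeChange (h0 : ∀ t, 0 ≤ t → 0 ≤ f t)
    (hi : ∀ t, 0 ≤ t → IntervalIntegrable f volume 0 t)
    (hsup : ∀ x y : ℝ, 0 ≤ x → 0 ≤ y → cumul f x + cumul f y ≤ cumul f (x + y)) (s : ℝ≥0) :
    ∃ v : ℝ≥0 → ℝ≥0, Monotone v ∧ (∀ u, u ≤ v u) ∧
      ∀ u : ℝ≥0, cumul f (v u) = cumul f (s + u) - cumul f s := by
  have hs := s.coe_nonneg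
  -- `v u` is the largest element of `A u`, a generalized inverse since `cumul f` may have flat
  -- stretches. The cap `s + u` bounds the set, and superadditivity puts `u` in it.
  let A : ℝ≥0 → Set ℝ := fun u ↦
    {x | x ∈ Set.Icc (0 : ℝ) (s + u) ∧ cumul f x ≤ cumul f (s + u) - cumul f s}
  have hbdd : ∀ u, BddAbove (A u) := fun u ↦ ⟨s + u, fun x hx ↦ hx.1.2⟩
  have hmem : ∀ u : ℝ≥0, (u : ℝ) ∈ A u := fun u ↦
    ⟨⟨u.2, by linarith⟩, by linarith [hsup s u s.2 u.2]⟩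
  have hle : ∀ u : ℝ≥0, (u : ℝ) ≤ sSup (A u) := fun u ↦ le_csSup (hbdd u) (hmem u)
  have hnn : ∀ u, 0 ≤ sSup (A u) := fun u ↦ u.coe_nonneg.trans (hle u)
  refine ⟨fun u ↦ ⟨sSup (A u), hnn u⟩, fun a b hab ↦ ?_, hle, fun u ↦ ?_⟩
  · have hab' : (a : ℝ) ≤ b := hab
    refine csSup_le_csSup (hbdd b) ⟨_, hmem a⟩ fun x hx ↦ ⟨⟨hx.1.1, hx.1.2.trans (by linarith)⟩, ?_⟩
    have := cumul_mono h0 hi (add_nonneg hs a.coe_nonneg) (show (s : ℝ) + a ≤ s + b by linarith)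
    linarith [hx.2]
  · have hsu : (0 : ℝ) ≤ s + u := add_nonneg hs u.coe_nonneg
    have hcont := continuousOn_cumul hi hsu
    have hclosed : IsClosed (A u) :=
      hcont.preimage_isClosed_of_isClosed isClosed_Icc isClosed_Iic
    have hin : sSup (A u) ∈ A u := hclosed.csSup_mem ⟨_, hmem u⟩ (hbdd u)
    refine le_antisymm hin.2 ?_
    -- If the maximum fell short of the target value, the intermediate value theorem would reach
    -- that value at a point of `A u` beyond it.
    by_contra! hlt
    have hpos : 0 ≤ cumul f s := by
      have := cumul_mono h0 hi le_rfl hs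
      rwa [cumul_zero] at this
    obtain ⟨x, hx, hfx⟩ := intermediate_value_Icc hin.1.2
      (hcont.mono (Set.Icc_subset_Icc_left hin.1.1))
      (⟨hlt.le, by linarith⟩ : cumul f (s + u) - cumul f s ∈
        Set.Icc (cumul f (sSup (A u))) (cumul f (s + u)))
    have hxA : x ∈ A u := ⟨⟨hin.1.1.trans hx.1, hx.2⟩, hfx.le⟩
    have hxe : x = sSup (A u) := le_antisymm (le_csSup (hbdd u) hxA) hx.1
    have hlt' : cumul f (sSup (A u)) < cumul f (s + u) - cumul f s := hlt
    rw [← hxe, hfx] at hlt'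
    exact lt_irrefl _ hlt'

theorem cumul_of_eq_const {c : ℝ} (hc : ∀ t, 0 ≤ t → f t = c) {t : ℝ} (ht : 0 ≤ t) :
    cumul f t = c * t := by
  rw [cumul, intervalIntegral.integral_congr (g := fun _ ↦ c)]
  · simp [mul_comm]
  · intro x hx
    rw [Set.uIcc_of_le ht] at hx
    exact hc x hx.1

end Cumul

/-! ### Integration under independence -/

section Independence

variable {Ω : Type*} [MeasurableSpace Ω] {P : Measure Ω} [IsProbabilityMeasure P]

/-- Integration of a function of two independent random variables. -/
theorem lintegral_of_indepFun {E F : Type*} [MeasurableSpace E] [MeasurableSpace F]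
    {X : Ω → E} {Y : Ω → F} (hX : Measurable X) (hY : Measurable Y) (h : X ⟂ᵢ[P] Y)
    {f : E × F → ℝ≥0∞} (hf : Measurable f) :
    ∫⁻ ω, f (X ω, Y ω) ∂P = ∫⁻ ω, ∫⁻ ω', f (X ω, Y ω') ∂P ∂P := by
  have h1 := (indepFun_iff_map_prod_eq_prod_map_map hX.aemeasurable hY.aemeasurable).1 h
  have : IsProbabilityMeasure (P.map Y) := Measure.isProbabilityMeasure_map hY.aemeasurable
  rw [← lintegral_map hf (hX.prodMk hY), h1, lintegral_prod _ hf.aemeasurable,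
    lintegral_map (Measurable.lintegral_prod_right' hf) hX]
  refine lintegral_congr fun ω ↦ ?_
  exact lintegral_map (hf.comp measurable_prodMk_left) hY

/-- The marks of the first `n` shocks and the following marks contribute independently. -/
theorem lintegral_marks_mul {V : ℕ → Ω → ℝ × ℝ} (hVm : ∀ i, Measurable (V i))
    (hV : iIndepFun V P) (hVid : ∀ i, IdentDistrib (V i) (V 0) P P) (n : ℕ)
    {f g : (ℕ → ℝ × ℝ) → ℝ≥0∞} (hf : Measurable f) (hg : Measurable g)
    (hdep : ∀ v w : ℕ → ℝ × ℝ, (∀ i < n, v i = w i) → f v = f w) :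
    ∫⁻ ω, f (fun i ↦ V i ω) * g (fun i ↦ V (n + i) ω) ∂P =
      (∫⁻ ω, f (fun i ↦ V i ω) ∂P) * ∫⁻ ω, g (fun i ↦ V i ω) ∂P := by
  have hVm' : Measurable fun ω i ↦ V i ω := measurable_pi_lambda _ hVm
  have hVn : Measurable fun ω i ↦ V (n + i) ω := measurable_pi_lambda _ fun i ↦ hVm _
  -- Padding by `0` turns `f`, which sees only the first `n` marks, into a measurable function of
  -- that finite block.
  let e : (Finset.range n → ℝ × ℝ) → (ℕ → ℝ × ℝ) := fun d i ↦
    if hi : i ∈ Finset.range n then d ⟨i, hi⟩ else 0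
  have he : Measurable e := measurable_pi_lambda _ fun i ↦ by
    by_cases hi : i ∈ Finset.range n
    · simp only [e, hi, dif_pos]; fun_prop
    · simp only [e, hi, dif_neg, not_false_eq_true]; fun_prop
  have hfe : (fun ω ↦ f (fun i ↦ V i ω)) =
      (f ∘ e) ∘ fun ω (i : Finset.range n) ↦ V i ω := by
    ext ω
    exact hdep _ _ fun i hi ↦ by simp [e, hi]
  have hind : (fun ω ↦ f (fun i ↦ V i ω)) ⟂ᵢ[P] (fun ω ↦ g (fun i ↦ V (n + i) ω)) := by
    rw [hfe]
    exact (indepFun_initial_tail hVm hV n).comp (hf.comp he) hg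
  refine (lintegral_mul_eq_lintegral_mul_lintegral_of_indepFun'' (hf.comp hVm').aemeasurable
    (hg.comp hVn).aemeasurable hind).trans ?_
  congr 1
  have hid : P.map (fun ω i ↦ V (n + i) ω) = P.map (fun ω i ↦ V i ω) := by
    rw [iIndepFun.map_fun_eq_infinitePi_map (X := fun i ω ↦ V (n + i) ω) (fun i ↦ hVm _)
      (hV.precomp (g := (n + ·)) (add_right_injective n)),
      iIndepFun.map_fun_eq_infinitePi_map hVm hV]
    congr 1
    ext1 i
    exact (hVid _).map_eq.trans (hVid _).map_eq.symm
  simp only [Function.comp_apply]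
  rw [← lintegral_map hg hVn, hid, lintegral_map hg hVm']

end Independence

/-! ### The shock process seen from time `s` -/

section Poisson

namespace Objects

variable {Ω : Type*} [MeasurableSpace Ω] {P : Measure Ω} {S : Objects Ω} {lam : ℝ → ℝ}

namespace IsPoisson

theorem measurable_N (hS : S.IsPoisson P lam) (t : ℝ) : Measurable (S.N t) :=
  (measurable_count t).comp (measurable_pi_lambda _ hS.measurable)

theorem ae_isPointSeq (hS : S.IsPoisson P lam) : ∀ᵐ ω ∂P, IsPointSeq fun n ↦ S.T n ω := by
  filter_upwards [hS.pos, hS.strictMono, hS.locally_finite] with ω h1 h2 h3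
  refine ⟨fun i ↦ (h1 i).le, h2.monotone, fun t ↦ ?_⟩
  obtain ⟨k, hk⟩ := (h3.eventually_gt_atTop t).exists_forall_of_atTop
  refine (Set.finite_Iio k).subset fun i (hi : _ ≤ t) ↦ ?_
  by_contra h
  exact absurd (hk i (not_lt.1 h)) (not_lt.2 hi)

theorem ae_monotone_N (hS : S.IsPoisson P lam) :
    ∀ᵐ ω ∂P, Monotone fun t : ℝ≥0 ↦ S.N t ω := by
  filter_upwards [hS.ae_isPointSeq] with ω h a b hab
  exact h.count_mono (NNReal.coe_le_coe.2 hab)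

theorem ae_N_zero (hS : S.IsPoisson P lam) : ∀ᵐ ω ∂P, S.N 0 ω = 0 := by
  filter_upwards [hS.ae_isPointSeq, hS.pos] with ω h h1
  by_contra h2
  exact absurd (h.lt_count_iff.1 (Nat.pos_of_ne_zero h2)) (not_le.2 (h1 0))

/-- The process seen from time `s` has the law of a time change of the original process. -/
theorem identDistrib_timeChange [IsProbabilityMeasure P] (hS : S.IsPoisson P lam)
    (hpos : ∀ t, 0 < t → 0 < cumul lam t) (s : ℝ≥0) {v : ℝ≥0 → ℝ≥0} (hv : Monotone v)
    (hc : ∀ u : ℝ≥0, cumul lam (v u) = cumul lam (s + u) - cumul lam s) :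
    IdentDistrib (fun ω (u : ℝ≥0) ↦ S.N (s + u : ℝ≥0) ω - S.N s ω)
      (fun ω (u : ℝ≥0) ↦ S.N (v u) ω) P P := by
  have hNm := hS.measurable_N
  -- Here positivity of `Λ` on positive times is essential: `Λ (v 0) = 0` forces `v 0 = 0`, so the
  -- time-changed process starts from `0`.
  have hv0 : v 0 = 0 := by
    by_contra h
    have h1 := hpos (v 0) (NNReal.coe_pos.2 (pos_iff_ne_zero.2 h))
    rw [hc] at h1
    simp at h1
  have hincr : ∀ a b : ℝ≥0, a ≤ b → (fun ω ↦ S.N (s + b : ℝ≥0) ω - S.N (s + a : ℝ≥0) ω) =ᵐ[P]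
      fun ω ↦ (S.N (s + b : ℝ≥0) ω - S.N s ω) - (S.N (s + a : ℝ≥0) ω - S.N s ω) := by
    intro a b _
    filter_upwards [hS.ae_monotone_N] with ω h
    have h1 : S.N s ω ≤ S.N (s + a : ℝ≥0) ω := h (le_self_add : s ≤ s + a)
    omega
  refine identDistrib_of_indepIncrements (X := fun u ω ↦ S.N (s + u : ℝ≥0) ω - S.N s ω)
    (Y := fun u ω ↦ S.N (v u) ω) (fun u ↦ (hNm _).sub (hNm _)) (fun u ↦ hNm _) ?_ ?_ ?_ ?_ ?_ ?_ ?_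
  · intro n t ht
    have := hS.indep_increments n (fun i ↦ s + t i) (fun i j hij ↦ add_le_add_right (ht hij) s)
    exact this.congr fun i ↦ hincr _ _ (ht (Fin.castSucc_lt_succ).le)
  · exact fun n t ht ↦ hS.indep_increments n (fun i ↦ v (t i)) (hv.comp ht)
  · exact Eventually.of_forall fun ω ↦ by simp
  · simpa only [hv0, NNReal.coe_zero] using hS.ae_N_zero
  · filter_upwards [hS.ae_monotone_N] with ω h a b hab
    exact Nat.sub_le_sub_right (h (add_le_add_right hab s)) _
  · filter_upwards [hS.ae_monotone_N] with ω h a b hab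
    exact h (hv hab)
  · intro a b hab
    have h1 := hS.law_increments (s + a) (s + b) (add_le_add_right hab s)
    have h2 := hS.law_increments (v a) (v b) (hv hab)
    have h3 : cumul lam (v b) - cumul lam (v a) =
        cumul lam (s + b : ℝ≥0) - cumul lam (s + a : ℝ≥0) := by
      rw [hc, hc]; push_cast; ring
    rw [h3] at h2
    exact (IdentDistrib.of_ae_eq ((hNm _).sub (hNm _)).aemeasurable (hincr a b hab)).symm.trans
      (h1.identDistrib h2)

end IsPoisson

end Objects

end Poisson

/-! ### Submultiplicativity of the mean survival -/

namespace Objects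

variable {Ω : Type*} [MeasurableSpace Ω]

/-- The probability that the intrinsic deterioration stays below `L - a` slightly beyond
time `t`. -/
noncomputable def reserve (S : Objects Ω) (P : Measure Ω) (L : ℝ) (t : ℝ≥0) (a : ℝ) : ℝ≥0∞ :=
  P {ω | ∃ n : ℕ, S.G (t + 1 / ((n : ℝ≥0) + 1)) ω ≤ L - a}

/-- The survival functional, averaged over the marks of the shocks. -/
noncomputable def meanSurvival (S : Objects Ω) (P : Measure Ω) (q : ℝ → ℝ) (L : ℝ) (t : ℝ≥0)
    (x : ℕ → ℝ) : ℝ≥0∞ :=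
  ∫⁻ ω, survival q (S.reserve P L t) t x (fun i ↦ S.V i ω) ∂P

variable {S : Objects Ω} {P : Measure Ω} {h lam q : ℝ → ℝ} {L : ℝ}

theorem antitone_reserve (t : ℝ≥0) : Antitone (S.reserve P L t) := by
  intro a b hab
  refine measure_mono fun ω ↦ ?_
  rintro ⟨n, hn⟩
  exact ⟨n, hn.trans (by linarith)⟩

theorem measurable_reserve (t : ℝ≥0) : Measurable (S.reserve P L t) :=
  (antitone_reserve t).measurable

namespace IsModel

/-- With `l = L - (a + b)`, the NBU bound at level `l` suffices because `l ≤ L - a` and `l ≤ L - b`.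
The margin beyond `s + t`, present because `G` need not be right-continuous, is shared equally
between `s` and `t`. -/
theorem reserve_add_le [IsProbabilityMeasure P] (hS : S.IsModel P h lam q L) (hG : IntrinsicNBU₂ S.G P) (s t : ℝ≥0)
    {a b : ℝ} (ha : 0 ≤ a) (hb : 0 ≤ b) :
    S.reserve P L (s + t) (a + b) ≤ S.reserve P L s a * S.reserve P L t b := by
  -- The NBU hypothesis covers only levels `l ≥ 0`; below `0` the left side vanishes as `G` is
  -- nonnegative.
  rcases lt_or_ge (L - (a + b)) 0 with hl | hl
  · have : S.reserve P L (s + t) (a + b) = 0 := by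
      refine measure_mono_null (t := {ω | ¬ ∀ t, 0 ≤ S.G t ω}) ?_ hS.G_nonneg
      rintro ω ⟨n, hn⟩ hω
      exact absurd (hω _) (not_le.2 (hn.trans_lt hl))
    simp [this]
  set l := L - (a + b)
  have hmul : ∀ u v : ℝ≥0, P {ω | S.G (u + v) ω ≤ l} ≤ P {ω | S.G u ω ≤ l} * P {ω | S.G v ω ≤ l} := by
    intro u v
    have : ∀ u, IsProbabilityMeasure (P.map (S.G u)) := fun u ↦
      Measure.isProbabilityMeasure_map (hS.G_measurable u).aemeasurable
    have h1 := hG l v u hl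
    simp only [cdf_eq_real, measureReal_def,
      Measure.map_apply (hS.G_measurable _) measurableSet_Iic, ← ENNReal.toReal_mul] at h1
    exact (ENNReal.toReal_le_toReal (by finiteness) (by finiteness)).1 h1
  let E : ℕ → Set Ω := fun n ↦ {ω | S.G (s + t + 1 / ((n : ℝ≥0) + 1)) ω ≤ l}
  have hE : {ω | ∃ n : ℕ, S.G (s + t + 1 / ((n : ℝ≥0) + 1)) ω ≤ l} = ⋃ n, E n := by
    ext ω; simp [E]
  rw [reserve, hE, measure_iUnion_eq_iSup_accumulate]
  refine iSup_le fun n ↦ ?_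
  -- Monotone paths make the events `E n` increase up to null sets.
  have hacc : P (Set.accumulate E n) ≤ P (E n) := by
    refine measure_mono_ae ?_
    filter_upwards [hS.G_monotone] with ω hω hmem
    obtain ⟨k, hk, hkE⟩ := Set.mem_accumulate.1 hmem
    have hle : s + t + 1 / ((n : ℝ≥0) + 1) ≤ s + t + 1 / ((k : ℝ≥0) + 1) := by gcongr
    exact (hω hle).trans hkE
  refine hacc.trans ?_
  -- Half of `1 / (n + 1)` is the margin of index `2 * n + 1`.
  have hhalf : s + t + 1 / ((n : ℝ≥0) + 1) =
      (s + 1 / (((2 * n + 1 : ℕ) : ℝ≥0) + 1)) + (t + 1 / (((2 * n + 1 : ℕ) : ℝ≥0) + 1)) := by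
    have : (1 : ℝ≥0) / ((n : ℝ≥0) + 1) = 2 * (1 / (((2 * n + 1 : ℕ) : ℝ≥0) + 1)) := by
      push_cast
      field_simp
      ring
    rw [this]; ring
  simp only [E]
  rw [hhalf]
  refine (hmul _ _).trans (mul_le_mul' ?_ ?_)
  · exact measure_mono fun ω hω ↦ ⟨2 * n + 1, le_trans hω (by simp only [l]; linarith)⟩
  · exact measure_mono fun ω hω ↦ ⟨2 * n + 1, le_trans hω (by simp only [l]; linarith)⟩

theorem ae_V_nonneg (hS : S.IsModel P h lam q L) :
    ∀ᵐ ω ∂P, ∀ i, 0 ≤ (S.V i ω).1 ∧ 0 ≤ (S.V i ω).2 :=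
  ae_all_iff.2 hS.V_nonneg

theorem measurable_T (hS : S.IsModel P h lam q L) : Measurable fun ω n ↦ S.T n ω :=
  measurable_pi_lambda _ hS.poisson.measurable

theorem measurable_V (hS : S.IsModel P h lam q L) : Measurable fun ω n ↦ S.V n ω :=
  measurable_pi_lambda _ hS.V_measurable

theorem measurable_meanSurvival [IsProbabilityMeasure P] (hS : S.IsModel P h lam q L) (t : ℝ≥0) :
    Measurable (S.meanSurvival P q L t) := by
  have h1 := measurable_survival hS.q_measurable (measurable_reserve (S := S) (P := P) (L := L) t) t
  have h2 : Measurable fun p : (ℕ → ℝ) × Ω ↦ (p.1, fun i ↦ S.V i p.2) :=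
    measurable_fst.prodMk (hS.measurable_V.comp measurable_snd)
  exact Measurable.lintegral_prod_right' (h1.comp h2)

theorem lintegral_survival [IsProbabilityMeasure P] (hS : S.IsModel P h lam q L) (t : ℝ≥0) :
    ∫⁻ ω, survival q (S.reserve P L t) t (fun n ↦ S.T n ω) (fun n ↦ S.V n ω) ∂P =
      ∫⁻ ω, S.meanSurvival P q L t (fun n ↦ S.T n ω) ∂P :=
  lintegral_of_indepFun hS.measurable_T hS.measurable_V hS.V_indep_T.symm
    (measurable_survival hS.q_measurable (measurable_reserve t) t)

theorem measurable_shiftPoints (s : ℝ) : Measurable (shiftPoints s) := by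
  refine measurable_pi_lambda _ fun i ↦ ?_
  exact measurable_of_index (f := fun n (x : ℕ → ℝ) ↦ x (n + i) - s) (fun n ↦ by fun_prop)
    (measurable_count s)

/-- Independence of the marks before and after time `s`. -/
theorem lintegral_survival_mul [IsProbabilityMeasure P] (hS : S.IsModel P h lam q L) (s t : ℝ≥0) :
    ∫⁻ ω, survival q (S.reserve P L s) s (fun n ↦ S.T n ω) (fun n ↦ S.V n ω) *
        survival q (S.reserve P L t) t (shiftPoints s fun n ↦ S.T n ω)
          (fun i ↦ S.V (count (fun n ↦ S.T n ω) s + i) ω) ∂P =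
      ∫⁻ ω, S.meanSurvival P q L s (fun n ↦ S.T n ω) *
        S.meanSurvival P q L t (shiftPoints s fun n ↦ S.T n ω) ∂P := by
  have hm1 := measurable_survival hS.q_measurable (measurable_reserve (S := S) (P := P) (L := L) s) s
  have hm2 := measurable_survival hS.q_measurable (measurable_reserve (S := S) (P := P) (L := L) t) t
  have hshift : Measurable fun p : (ℕ → ℝ) × (ℕ → ℝ × ℝ) ↦ fun i ↦ p.2 (count p.1 s + i) :=
    measurable_pi_lambda _ fun i ↦ measurable_of_index
      (f := fun n (p : (ℕ → ℝ) × (ℕ → ℝ × ℝ)) ↦ p.2 (n + i))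
      (fun n ↦ by fun_prop) ((measurable_count s).comp measurable_fst)
  have hm2' := measurable_survival_comp hS.q_measurable
    (measurable_reserve (S := S) (P := P) (L := L) t) t
    ((measurable_shiftPoints s).comp measurable_fst) hshift
  have hprod := hm1.mul hm2'
  have h1 := lintegral_of_indepFun hS.measurable_T hS.measurable_V hS.V_indep_T.symm hprod
  -- With the arrivals frozen, the number of shocks before `s` is deterministic and the marks split
  -- at a fixed index.
  refine Eq.trans h1 (lintegral_congr fun ω ↦ ?_)
  have hf := hm1.comp (measurable_prodMk_left (x := fun n ↦ S.T n ω))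
  have hg := hm2.comp (measurable_prodMk_left (x := shiftPoints s fun n ↦ S.T n ω))
  have h2 := lintegral_marks_mul hS.V_measurable hS.V_indep hS.V_identDistrib
    (count (fun n ↦ S.T n ω) s) hf hg (fun v w hvw ↦ survival_congr rfl (fun _ _ ↦ rfl) hvw)
  exact h2

/-- The points of a counting path up to time `s`, completed by points after `s`. -/
noncomputable def pastPoints (s : ℝ≥0) (M : ℝ≥0 → ℕ) (i : ℕ) : ℝ :=
  if i < M s then pathPoints M i else s + 1

theorem measurable_pastPoints (s : ℝ≥0) : Measurable (pastPoints s) := by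
  refine measurable_pi_lambda _ fun i ↦ Measurable.ite ?_ ?_ measurable_const
  · exact measurableSet_lt measurable_const (measurable_pi_apply _)
  · exact (measurable_pi_apply i).comp measurable_pathPoints

/-- Exhibits the survival up to `s` as a function of the path stopped at `s`: the stopped path
forgets the later points, and their substitutes at `s + 1` are not counted. -/
theorem meanSurvival_pastPoints {x : ℕ → ℝ} (hx : IsPointSeq x) (s : ℝ≥0) :
    S.meanSurvival P q L s (pastPoints s fun u ↦ count x (min u s : ℝ≥0)) =
      S.meanSurvival P q L s x := by
  have hlt : ∀ i < count x s, pastPoints s (fun u ↦ count x (min u s : ℝ≥0)) i = x i := by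
    intro i hi
    have hxi := hx.lt_count_iff.1 hi
    rw [pastPoints, if_pos (by simpa using hi), pathPoints, pathPointsE_eq (a := x i),
      ENNReal.toReal_ofReal (hx.nonneg i)]
    intro r
    rw [hx.lt_count_iff]
    simp [hxi]
  have hge : ∀ i, ¬ i < count x s →
      pastPoints s (fun u ↦ count x (min u s : ℝ≥0)) i = s + 1 := by
    intro i hi
    rw [pastPoints, if_neg (by simpa using hi)]
  have hcount : count (pastPoints s fun u ↦ count x (min u s : ℝ≥0)) s = count x s := by
    rw [count]
    conv_rhs => rw [count]
    congr 1
    ext i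
    simp only [Set.mem_ofPred_eq]
    by_cases hi : i < count x s
    · rw [hlt i hi]
    · rw [hge i hi, ← hx.lt_count_iff]
      simp [hi]
  exact lintegral_congr fun ω ↦ survival_congr hcount hlt (fun _ _ ↦ rfl)

/-- Independence of the shocks before and after time `s`. -/
theorem lintegral_meanSurvival_mul [IsProbabilityMeasure P] (hS : S.IsModel P h lam q L) (s t : ℝ≥0) :
    ∫⁻ ω, S.meanSurvival P q L s (fun n ↦ S.T n ω) *
        S.meanSurvival P q L t (shiftPoints s fun n ↦ S.T n ω) ∂P =
      (∫⁻ ω, S.meanSurvival P q L s (fun n ↦ S.T n ω) ∂P) *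
        ∫⁻ ω, S.meanSurvival P q L t (shiftPoints s fun n ↦ S.T n ω) ∂P := by
  have hind := indepFun_past_future (X := fun (u : ℝ≥0) ω ↦ S.N u ω)
    (fun u ↦ hS.poisson.measurable_N u) hS.poisson.indep_increments
    (by simpa using hS.poisson.ae_N_zero) hS.poisson.ae_monotone_N s
  have hN : ∀ᵐ ω ∂P, S.meanSurvival P q L s (pastPoints s fun u ↦ S.N (min u s : ℝ≥0) ω) =
      S.meanSurvival P q L s (fun n ↦ S.T n ω) := by
    filter_upwards [hS.poisson.ae_isPointSeq] with ω hω
    exact meanSurvival_pastPoints hω s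
  have hN' : ∀ᵐ ω ∂P, S.meanSurvival P q L t
      (pathPoints fun u ↦ S.N (s + u : ℝ≥0) ω - S.N s ω) =
      S.meanSurvival P q L t (shiftPoints s fun n ↦ S.T n ω) := by
    filter_upwards [hS.poisson.ae_isPointSeq] with ω hω
    rw [← hω.pathPoints_shift s]
    rfl
  have hind' := (hind.comp ((hS.measurable_meanSurvival s).comp (measurable_pastPoints s))
    ((hS.measurable_meanSurvival t).comp measurable_pathPoints)).congr hN hN'
  exact lintegral_mul_eq_lintegral_mul_lintegral_of_indepFun''
    ((hS.measurable_meanSurvival s).comp hS.measurable_T).aemeasurable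
    ((hS.measurable_meanSurvival t).comp
      ((measurable_shiftPoints s).comp hS.measurable_T)).aemeasurable hind'

/-- The shocks after time `s` are at least as harmful as the initial ones, as soon as they are
obtained from the latter by an advancing time change that does not improve the non fatality
probabilities. -/
theorem lintegral_meanSurvival_shift_le [IsProbabilityMeasure P] (hS : S.IsModel P h lam q L) (s t : ℝ≥0)
    {v : ℝ≥0 → ℝ≥0} (hv : Monotone v) (hle : ∀ u, u ≤ v u)
    (hc : ∀ u : ℝ≥0, cumul lam (v u) = cumul lam (s + u) - cumul lam s)
    (hqv : (∀ u, v u = u) ∨ ∃ c, ∀ u, 0 ≤ u → q u = c) :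
    ∫⁻ ω, S.meanSurvival P q L t (shiftPoints s fun n ↦ S.T n ω) ∂P ≤
      ∫⁻ ω, S.meanSurvival P q L t (fun n ↦ S.T n ω) ∂P := by
  have hid := (hS.poisson.identDistrib_timeChange hS.cumul_lam_pos s hv hc).comp
    ((hS.measurable_meanSurvival t).comp measurable_pathPoints)
  have h1 : ∫⁻ ω, S.meanSurvival P q L t (shiftPoints s fun n ↦ S.T n ω) ∂P =
      ∫⁻ ω, S.meanSurvival P q L t (pathPoints fun u ↦ S.N (v u) ω) ∂P := by
    refine Eq.trans (lintegral_congr_ae ?_) hid.lintegral_eq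
    filter_upwards [hS.poisson.ae_isPointSeq] with ω hω
    rw [← hω.pathPoints_shift s]
    rfl
  rw [h1]
  refine lintegral_mono_ae ?_
  filter_upwards [hS.poisson.ae_isPointSeq] with ω hω
  obtain ⟨hseq, hpts⟩ : IsPointSeq (pathPoints fun u ↦ S.N (v u) ω) ∧
      ∀ i, pathPoints (fun u ↦ S.N (v u) ω) i ≤ S.T i ω := hω.pathPoints_timeChange hv hle
  -- If `v` is the identity the points coincide and any `q` is allowed. If shocks are truly
  -- advanced, a constant `q` prevents earlier shocks from being less often fatal.
  rcases hqv with hid | ⟨c, hqc⟩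
  · have : (pathPoints fun u ↦ S.N (v u) ω) = fun n ↦ S.T n ω := by
      simp only [hid]
      exact hω.pathPoints_count
    rw [this]
  · refine lintegral_mono_ae ?_
    filter_upwards [hS.ae_V_nonneg] with ω' hV
    refine survival_le_survival (antitone_reserve t) hseq hpts hV (fun i ↦ ?_)
      fun i ↦ (hS.q_mem _ (hseq.nonneg i)).2
    rw [hqc _ (hseq.nonneg i), hqc _ (hω.nonneg i)]

end IsModel

end Objects

/-! ### Survival probability of the system -/

namespace Objects

variable {Ω : Type*} [MeasurableSpace Ω] {S : Objects Ω} {P : Measure Ω} {h lam q : ℝ → ℝ} {L : ℝ}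

namespace IsModel

theorem measurable_A (hS : S.IsModel P h lam q L) (t : ℝ) : Measurable (S.A t) := by
  have hV := hS.V_measurable
  exact measurable_of_index (f := fun n ω ↦ ∑ k ∈ Finset.range n, S.V k ω)
    (fun n ↦ by fun_prop) (hS.poisson.measurable_N t)

theorem history_le (hS : S.IsModel P h lam q L) (t : ℝ≥0) : S.history t ≤ ‹MeasurableSpace Ω› :=
  iSup₂_le fun s _ ↦
    ((hS.poisson.measurable_N s).prodMk (hS.measurable_A s)).comap_le

theorem measurable_τ₃ (hS : S.IsModel P h lam q L) : Measurable S.τ₃ := by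
  classical
  have : S.τ₃ = fun ω ↦ ⨅ n, if ω ∈ S.fatal n then ENNReal.ofReal (S.T n ω) else ⊤ := by
    ext ω
    refine iInf_congr fun n ↦ ?_
    by_cases hn : ω ∈ S.fatal n <;> simp [hn]
  rw [this]
  exact Measurable.iInf fun n ↦ Measurable.ite (hS.fatal_measurable n)
    (hS.poisson.measurable n).ennreal_ofReal measurable_const

theorem A_mono {Ω : Type*} {S : Objects Ω} {ω : Ω} (hω : IsPointSeq fun n ↦ S.T n ω)
    (hV : ∀ i, 0 ≤ (S.V i ω).1 ∧ 0 ≤ (S.V i ω).2) {s t : ℝ} (hst : s ≤ t) :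
    (S.A s ω).2 ≤ (S.A t ω).2 := by
  simp only [A, Prod.snd_sum]
  exact Finset.sum_le_sum_of_subset_of_nonneg
    (Finset.range_subset_range.2 (hω.count_mono hst)) fun i _ _ ↦ (hV i).2

/-- The second component survives time `t` if and only if its deterioration stays below the
threshold slightly beyond `t`. -/
theorem ae_lt_τ₂_iff (hS : S.IsModel P h lam q L) (t : ℝ≥0) :
    ∀ᵐ ω ∂P, (t : ℝ≥0∞) < S.τ₂ L ω ↔
      ∃ n : ℕ, S.G (t + 1 / ((n : ℝ≥0) + 1)) ω ≤ L - (S.A t ω).2 := by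
  filter_upwards [hS.poisson.ae_isPointSeq, hS.ae_V_nonneg, hS.G_monotone] with ω hω hV hG
  have hlim : ∀ b : ℝ≥0∞, (t : ℝ≥0∞) < b → ∃ n₀ : ℕ, ∀ n ≥ n₀,
      ((t + 1 / ((n : ℝ≥0) + 1) : ℝ≥0) : ℝ≥0∞) < b := by
    intro b hb
    have h1 : Tendsto (fun n : ℕ ↦ ((t + 1 / ((n : ℝ≥0) + 1) : ℝ≥0) : ℝ≥0∞)) atTop (𝓝 t) := by
      rw [ENNReal.tendsto_coe]
      simpa using (tendsto_one_div_add_atTop_nhds_zero_nat (𝕜 := ℝ≥0)).const_add t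
    exact (h1.eventually_lt_const hb).exists_forall_of_atTop
  constructor
  · intro hlt
    obtain ⟨n, hn⟩ := hlim _ hlt
    refine ⟨n, ?_⟩
    have h1 : ¬ L < S.X₂ (t + 1 / ((n : ℝ≥0) + 1)) ω := fun hL ↦
      (hn n le_rfl).not_ge (iInf₂_le (f := fun (r : ℝ≥0) (_ : L < S.X₂ r ω) ↦ (r : ℝ≥0∞)) _ hL)
    have h2 : (S.A t ω).2 ≤ (S.A (t + 1 / ((n : ℝ≥0) + 1) : ℝ≥0) ω).2 :=
      A_mono hω hV (NNReal.coe_le_coe.2 le_self_add)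
    simp only [X₂, not_lt] at h1
    linarith
  · rintro ⟨n, hn⟩
    -- Numbering from `0` makes `T (N t)` the first shock after `t`. A time `u > t` chosen before it
    -- and within the margin sees no new shock, so no failure occurs before `u`.
    have hnext : (t : ℝ) < S.T (S.N t ω) ω := by
      have := (hω.lt_count_iff (t := t) (i := S.N t ω)).not.1 (lt_irrefl _)
      exact not_le.1 this
    obtain ⟨n₀, hn₀⟩ := hlim (ENNReal.ofReal (S.T (S.N t ω) ω)) (by
      rw [ENNReal.lt_ofReal_iff_toReal_lt ENNReal.coe_ne_top]; simpa using hnext)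
    set m := max n n₀
    have hm := hn₀ m (le_max_right _ _)
    rw [ENNReal.lt_ofReal_iff_toReal_lt ENNReal.coe_ne_top, ENNReal.coe_toReal] at hm
    set u : ℝ≥0 := t + 1 / ((m : ℝ≥0) + 1) with hu
    have hN : S.N u ω = S.N t ω := by
      refine le_antisymm ?_ (hω.count_mono (NNReal.coe_le_coe.2 le_self_add))
      by_contra! hlt
      exact absurd (hω.lt_count_iff.1 hlt) (not_le.2 hm)
    have hA : S.A u ω = S.A t ω := by simp only [A, hN]
    have htu : t < u := by
      rw [hu]; exact lt_add_of_pos_right t (by positivity)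
    refine lt_of_lt_of_le (ENNReal.coe_lt_coe.2 htu) (le_iInf₂ fun r hr ↦ ?_)
    rw [ENNReal.coe_le_coe]
    by_contra! hru
    have h1 : (S.A r ω).2 ≤ (S.A t ω).2 := by
      rw [← hA]; exact A_mono hω hV (NNReal.coe_le_coe.2 hru.le)
    have hle : u ≤ t + 1 / ((n : ℝ≥0) + 1) := by
      rw [hu]
      have : (n : ℝ≥0) ≤ m := by exact_mod_cast le_max_left n n₀
      gcongr
    have h2 : S.G r ω ≤ S.G (t + 1 / ((n : ℝ≥0) + 1)) ω := hG (hru.le.trans hle)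
    simp only [X₂] at hr
    linarith

/-- A shock arriving at `a` with mark `c` raises the hazard rate by `c` from then on. -/
theorem integral_ite_le {a t c : ℝ} (ha : 0 < a) (hat : a ≤ t) :
    IntervalIntegrable (fun s ↦ if a ≤ s then c else 0) volume 0 t ∧
      ∫ s in (0 : ℝ)..t, (if a ≤ s then c else 0) = c * (t - a) := by
  have hind : (fun s ↦ if a ≤ s then c else 0) = (Set.Ici a).indicator fun _ ↦ c := by
    ext s; simp [Set.indicator_apply]
  have hset : Set.Ioc 0 t ∩ Set.Ici a = Set.Icc a t := by
    ext s
    simp only [Set.mem_inter_iff, Set.mem_Ioc, Set.mem_Ici, Set.mem_Icc]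
    constructor
    · rintro ⟨⟨_, h2⟩, h3⟩; exact ⟨h3, h2⟩
    · rintro ⟨h1, h2⟩; exact ⟨⟨by linarith, h2⟩, h1⟩
  rw [hind, intervalIntegrable_iff_integrableOn_Ioc_of_le (ha.le.trans hat),
    intervalIntegral.integral_of_le (ha.le.trans hat)]
  refine ⟨(integrableOn_const (by simp)).indicator measurableSet_Ici, ?_⟩
  rw [setIntegral_indicator measurableSet_Ici, hset, setIntegral_const, measureReal_def,
    Real.volume_Icc, ENNReal.toReal_ofReal (by linarith), smul_eq_mul, mul_comm]

/-- The cumulated conditional hazard rate of the first component. -/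
theorem ae_integral_X₁ (hS : S.IsModel P h lam q L) (t : ℝ≥0) :
    ∀ᵐ ω ∂P, ∫ s in (0 : ℝ)..t, S.X₁ h s ω =
      cumul h t + ∑ i ∈ Finset.range (S.N t ω), (S.V i ω).1 * (t - S.T i ω) := by
  filter_upwards [hS.poisson.ae_isPointSeq, hS.poisson.pos] with ω hω hpos
  have hT : ∀ i ∈ Finset.range (S.N t ω), S.T i ω ≤ t := fun i hi ↦
    hω.lt_count_iff.1 (Finset.mem_range.1 hi)
  -- Indexing by the shocks up to `t`, with indicators, makes the range of summation independent of
  -- `s`.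
  have h1 : Set.EqOn (fun s ↦ S.X₁ h s ω) (fun s ↦ h s + ∑ i ∈ Finset.range (S.N t ω),
      if S.T i ω ≤ s then (S.V i ω).1 else 0) (Set.uIcc 0 (t : ℝ)) := by
    intro s hs
    rw [Set.uIcc_of_le t.coe_nonneg] at hs
    simp only [X₁, A, Prod.fst_sum]
    congr 1
    rw [← Finset.sum_filter]
    refine Finset.sum_congr ?_ fun _ _ ↦ rfl
    ext i
    have h2 : S.N s ω ≤ S.N t ω := hω.count_mono hs.2
    have h3 : i < S.N s ω ↔ S.T i ω ≤ s := hω.lt_count_iff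
    rw [Finset.mem_filter, Finset.mem_range, Finset.mem_range, ← h3]
    omega
  have hsum : IntervalIntegrable (fun s ↦ ∑ i ∈ Finset.range (S.N t ω),
      if S.T i ω ≤ s then (S.V i ω).1 else 0) volume 0 t := by
    have := IntervalIntegrable.sum (Finset.range (S.N t ω))
      fun i hi ↦ (integral_ite_le (c := (S.V i ω).1) (hpos i) (hT i hi)).1
    rw [Finset.sum_fn] at this
    exact this
  rw [intervalIntegral.integral_congr h1, intervalIntegral.integral_add
    (hS.h_integrable t t.coe_nonneg) hsum,
    intervalIntegral.integral_finsetSum fun i hi ↦ (integral_ite_le (hpos i) (hT i hi)).1]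
  congr 1
  exact Finset.sum_congr rfl fun i hi ↦ (integral_ite_le (hpos i) (hT i hi)).2

/-- The survival probability of the system in terms of the conditional survival probabilities
of the first and third failure modes. -/
theorem measure_lt_τ_eq_lintegral [IsProbabilityMeasure P] (hS : S.IsModel P h lam q L)
    (t : ℝ≥0) :
    P {ω | (t : ℝ≥0∞) < S.τ L ω} =
      ∫⁻ ω, ENNReal.ofReal (Real.exp (-∫ s in (0 : ℝ)..t, S.X₁ h s ω) *
          ∏ i ∈ Finset.range (S.N t ω), q (S.T i ω)) *
        {ω | ∃ n : ℕ, S.G (t + 1 / ((n : ℝ≥0) + 1)) ω ≤ L - (S.A t ω).2}.indicator 1 ω ∂P := by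
  have hm := hS.history_le t
  set B₂ := {ω | ∃ n : ℕ, S.G (t + 1 / ((n : ℝ≥0) + 1)) ω ≤ L - (S.A t ω).2} with hB₂
  set B := {ω | (t : ℝ≥0∞) < S.τ₁ ω ∧ (t : ℝ≥0∞) < S.τ₂ L ω ∧ (t : ℝ≥0∞) < S.τ₃ ω} with hB
  set Z : Ω → ℝ := fun ω ↦ Real.exp (-∫ s in (0 : ℝ)..t, S.X₁ h s ω) *
    ∏ i ∈ Finset.range (S.N t ω), q (S.T i ω) with hZ
  have hB₂m : MeasurableSet B₂ := by
    have : B₂ = ⋃ n : ℕ, {ω | S.G (t + 1 / ((n : ℝ≥0) + 1)) ω ≤ L - (S.A t ω).2} := by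
      ext; simp [hB₂]
    rw [this]
    exact MeasurableSet.iUnion fun n ↦ measurableSet_le (hS.G_measurable _)
      (measurable_const.sub (hS.measurable_A t).snd)
  have hτB : {ω | (t : ℝ≥0∞) < S.τ L ω} = B := by
    ext ω; simp [τ, hB]
  -- `τ₂` is an infimum over uncountably many times; its event is handled up to a null set through
  -- the measurable `B₂`.
  have hB₂ae : ({ω | (t : ℝ≥0∞) < S.τ₂ L ω} : Set Ω) =ᵐ[P] B₂ := by
    filter_upwards [hS.ae_lt_τ₂_iff t] with ω hω
    exact propext hω
  have hBnull : NullMeasurableSet B P := by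
    have hB₂null : NullMeasurableSet {ω | (t : ℝ≥0∞) < S.τ₂ L ω} P :=
      hB₂m.nullMeasurableSet.congr hB₂ae.symm
    have h1 : MeasurableSet {ω | (t : ℝ≥0∞) < S.τ₁ ω} :=
      measurableSet_lt measurable_const hS.τ₁_measurable
    have h3 : MeasurableSet {ω | (t : ℝ≥0∞) < S.τ₃ ω} :=
      measurableSet_lt measurable_const hS.measurable_τ₃
    exact h1.nullMeasurableSet.inter (hB₂null.inter h3.nullMeasurableSet)
  -- Measurability with respect to the history is inherited from the conditional probabilities that
  -- `Z` represents.
  have hZm : AEStronglyMeasurable[S.history t] Z P := by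
    have h1 : AEStronglyMeasurable[S.history t] (P⟦{ω | (t : ℝ≥0∞) < S.τ₁ ω} | S.history t⟧ *
        P⟦{ω | (t : ℝ≥0∞) < S.τ₃ ω} | S.history t⟧) P :=
      (stronglyMeasurable_condExp.mul stronglyMeasurable_condExp).aestronglyMeasurable
    refine h1.congr ?_
    filter_upwards [hS.τ₁_law t, hS.τ₃_law t] with ω h1 h3
    rw [Pi.mul_apply, h1, h3]
  have hZ01 : ∀ᵐ ω ∂P, 0 ≤ Z ω ∧ Z ω ≤ 1 := by
    filter_upwards [hS.poisson.ae_isPointSeq, hS.ae_V_nonneg] with ω hω hV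
    have hq := fun i ↦ hS.q_mem _ (hω.nonneg i)
    have hX : 0 ≤ ∫ s in (0 : ℝ)..t, S.X₁ h s ω := by
      refine intervalIntegral.integral_nonneg t.coe_nonneg fun u hu ↦
        add_nonneg (hS.h_nonneg u hu.1) ?_
      simp only [A, Prod.fst_sum]
      exact Finset.sum_nonneg fun i _ ↦ (hV i).1
    have hp0 : 0 ≤ ∏ i ∈ Finset.range (S.N t ω), q (S.T i ω) :=
      Finset.prod_nonneg fun i _ ↦ (hq i).1
    exact ⟨mul_nonneg (Real.exp_nonneg _) hp0, mul_le_one₀ (Real.exp_le_one_iff.2 (by linarith))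
      hp0 (Finset.prod_le_one (fun i _ ↦ (hq i).1) fun i _ ↦ (hq i).2)⟩
  have hind : Integrable (B₂.indicator fun _ ↦ (1 : ℝ)) P :=
    (integrable_const 1).indicator hB₂m
  have hZint : Integrable (Z * B₂.indicator fun _ ↦ (1 : ℝ)) P := by
    refine hind.bdd_mul (c := 1) (hZm.mono hm) ?_
    filter_upwards [hZ01] with ω hω
    rw [Real.norm_eq_abs, abs_of_nonneg hω.1]
    exact hω.2
  -- `Z` moves inside the conditional expectation of `B₂`, so the conditional law of `τ₂` is never
  -- computed.
  have hcond : P⟦B | S.history t⟧ =ᵐ[P] P[Z * B₂.indicator fun _ ↦ (1 : ℝ) | S.history t] := by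
    have h1 := condExp_mul_of_aestronglyMeasurable_left hZm hZint hind
    have h2 : P⟦{ω | (t : ℝ≥0∞) < S.τ₂ L ω} | S.history t⟧ =ᵐ[P] P⟦B₂ | S.history t⟧ :=
      condExp_congr_ae (indicator_ae_eq_of_ae_eq_set hB₂ae)
    filter_upwards [h1, h2, hS.cond_indep t, hS.τ₁_law t, hS.τ₃_law t] with ω e1 e2 e3 e4 e5
    rw [e3, e1]
    simp only [Pi.mul_apply, e2, e4, e5, hZ]
    ring
  have hreal : P.real B = ∫ ω, Z ω * B₂.indicator (fun _ ↦ (1 : ℝ)) ω ∂P := by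
    have h1 := integral_condExp (μ := P) (f := B.indicator fun _ ↦ (1 : ℝ)) hm
    have h2 := integral_condExp (μ := P) (f := Z * B₂.indicator fun _ ↦ (1 : ℝ)) hm
    rw [integral_congr_ae hcond, h2] at h1
    have h3 : ∫ ω, B.indicator (fun _ ↦ (1 : ℝ)) ω ∂P = P.real B := by
      rw [integral_indicator₀ hBnull]; simp
    rw [← h3, ← h1]
    rfl
  have hnn : 0 ≤ᵐ[P] fun ω ↦ Z ω * B₂.indicator (fun _ ↦ (1 : ℝ)) ω := by
    filter_upwards [hZ01] with ω hω
    exact mul_nonneg hω.1 (Set.indicator_nonneg (fun _ _ ↦ zero_le_one) _)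
  rw [hτB, ← ofReal_measureReal (μ := P) (s := B), hreal]
  refine (ofReal_integral_eq_lintegral_ofReal hZint hnn).trans ?_
  refine lintegral_congr fun ω ↦ ?_
  by_cases hω : ω ∈ B₂ <;> simp [hω, hZ]

/-- The survival probability of the system. -/
theorem measure_lt_τ [IsProbabilityMeasure P] (hS : S.IsModel P h lam q L) (t : ℝ≥0) :
    P {ω | (t : ℝ≥0∞) < S.τ L ω} = ENNReal.ofReal (Real.exp (-cumul h t)) *
      ∫⁻ ω, S.meanSurvival P q L t (fun n ↦ S.T n ω) ∂P := by
  classical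
  let E := ℕ → ℝ × ℝ × ℝ
  let c : E → ℕ := fun w ↦ count (fun n ↦ (w n).1) t
  have hc : Measurable c := (measurable_count t).comp (by fun_prop)
  let D : E → ℝ≥0∞ := fun w ↦
    ENNReal.ofReal (Real.exp (-∑ i ∈ Finset.range (c w), (w i).2.1 * (t - (w i).1))) *
      ∏ i ∈ Finset.range (c w), ENNReal.ofReal (q (w i).1)
  have hq := hS.q_measurable
  have hD : Measurable D := by
    refine Measurable.mul (ENNReal.measurable_ofReal.comp
      (Real.measurable_exp.comp (Measurable.neg ?_))) ?_
    · exact measurable_of_index (f := fun n (w : E) ↦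
        ∑ i ∈ Finset.range n, (w i).2.1 * (t - (w i).1)) (fun n ↦ by fun_prop) hc
    · exact measurable_of_index (f := fun n (w : E) ↦
        ∏ i ∈ Finset.range n, ENNReal.ofReal (q (w i).1)) (fun n ↦ by fun_prop) hc
  let a : E → ℝ := fun w ↦ ∑ i ∈ Finset.range (c w), (w i).2.2
  have ha : Measurable a := measurable_of_index (f := fun n (w : E) ↦
        ∑ i ∈ Finset.range n, (w i).2.2) (fun n ↦ by fun_prop) hc
  let U : Set (E × (ℝ≥0 → ℝ)) := {p | ∃ n : ℕ, p.2 (t + 1 / ((n : ℝ≥0) + 1)) ≤ L - a p.1}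
  have hU : MeasurableSet U := by
    have : U = ⋃ n : ℕ, {p | p.2 (t + 1 / ((n : ℝ≥0) + 1)) ≤ L - a p.1} := by
      ext; simp [U]
    rw [this]
    exact MeasurableSet.iUnion fun n ↦ measurableSet_le
      ((measurable_pi_apply _).comp measurable_snd)
      (measurable_const.sub (ha.comp measurable_fst))
  let W : Ω → E := fun ω n ↦ (S.T n ω, S.V n ω)
  have hW : Measurable W := measurable_pi_lambda _ fun n ↦
    (hS.poisson.measurable n).prodMk (hS.V_measurable n)
  let f : E × (ℝ≥0 → ℝ) → ℝ≥0∞ := fun p ↦ D p.1 * U.indicator 1 p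
  have hf : Measurable f := (hD.comp measurable_fst).mul (measurable_one.indicator hU)
  have hGm : Measurable fun ω s ↦ S.G s ω := measurable_pi_lambda _ hS.G_measurable
  have hfub := lintegral_of_indepFun hW hGm hS.G_indep.symm hf
  -- With the shocks frozen, averaging over `G` turns the indicator of `U` into `reserve`.
  have hinner : ∀ ω, ∫⁻ ω', f (W ω, fun s ↦ S.G s ω') ∂P =
      survival q (S.reserve P L t) t (fun n ↦ S.T n ω) (fun n ↦ S.V n ω) := by
    intro ω
    have hUm : MeasurableSet ((fun ω' ↦ (W ω, fun s ↦ S.G s ω')) ⁻¹' U) :=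
      (measurable_const.prodMk hGm) hU
    have h1 : ∀ ω', U.indicator (1 : E × (ℝ≥0 → ℝ) → ℝ≥0∞) (W ω, fun s ↦ S.G s ω') =
        ((fun ω' ↦ (W ω, fun s ↦ S.G s ω')) ⁻¹' U).indicator 1 ω' := fun ω' ↦ rfl
    simp only [f, h1]
    rw [lintegral_const_mul _ (measurable_one.indicator hUm), lintegral_indicator_one hUm]
    rfl
  rw [← hS.lintegral_survival, ← lintegral_congr hinner, ← hfub,
    ← lintegral_const_mul' _ _ ENNReal.ofReal_ne_top, hS.measure_lt_τ_eq_lintegral]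
  refine lintegral_congr_ae ?_
  filter_upwards [hS.ae_integral_X₁ t, hS.poisson.ae_isPointSeq] with ω hX hω
  have h1 : {ω | ∃ n : ℕ, S.G (t + 1 / ((n : ℝ≥0) + 1)) ω ≤ L - (S.A t ω).2}.indicator
      (1 : Ω → ℝ≥0∞) ω = U.indicator 1 (W ω, fun s ↦ S.G s ω) := by
    have hA : (S.A t ω).2 = a (W ω) := by
      simp only [A, Prod.snd_sum]
      rfl
    simp only [Set.indicator_apply, Set.mem_ofPred_eq, U, hA]
    rfl
  rw [h1, hX, neg_add, Real.exp_add, ENNReal.ofReal_mul (by positivity),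
    ENNReal.ofReal_mul (by positivity),
    ENNReal.ofReal_prod_of_nonneg fun i _ ↦ (hS.q_mem _ (hω.nonneg i)).1]
  simp only [f, D, ← mul_assoc]
  rfl

end IsModel

end Objects

end ShockSystem

/-! ### The main theorem -/

theorem mainTheorem6 {Ω : Type*} [MeasurableSpace Ω] (P : Measure Ω) [IsProbabilityMeasure P] :
    (∀ G : ℝ≥0 → Ω → ℝ, ShockSystem.IsLevyProcess G P → (∀ t, ∀ᵐ ω ∂P, 0 ≤ G t ω) →
      ShockSystem.IntrinsicNBU₂ G P) ∧
    (∀ (S : ShockSystem.Objects Ω) (h lam q : ℝ → ℝ) (L : ℝ),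
      S.IsModel P h lam q L →
      ShockSystem.IntrinsicNBU₁ h →
      ShockSystem.IntrinsicNBU₂ S.G P →
      ((AntitoneOn q (Set.Ici 0) ∧ ∃ c : ℝ, ∀ t, 0 ≤ t → lam t = c) ∨
        ((∃ c : ℝ, ∀ t, 0 ≤ t → q t = c) ∧
          ∀ x y : ℝ, 0 ≤ x → 0 ≤ y →
            ShockSystem.cumul lam x + ShockSystem.cumul lam y
              ≤ ShockSystem.cumul lam (x + y))) →
      ShockSystem.IsNBU (S.τ L) P) := by
  refine ⟨fun G hG h0 ↦ hG.intrinsicNBU₂ h0, fun S h lam q L hS hh hG hcase s t ↦ ?_⟩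
  obtain ⟨v, hv, hle, hc, hqv⟩ : ∃ v : ℝ≥0 → ℝ≥0, Monotone v ∧ (∀ u, u ≤ v u) ∧
      (∀ u : ℝ≥0, ShockSystem.cumul lam (v u) =
        ShockSystem.cumul lam (s + u) - ShockSystem.cumul lam s) ∧
      ((∀ u, v u = u) ∨ ∃ c, ∀ u, 0 ≤ u → q u = c) := by
    rcases hcase with ⟨-, c, hlam⟩ | ⟨hq, hsup⟩
    · refine ⟨id, monotone_id, fun _ ↦ le_rfl, fun u ↦ ?_, Or.inl fun _ ↦ rfl⟩
      rw [id, ShockSystem.cumul_of_eq_const hlam u.coe_nonneg,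
        ShockSystem.cumul_of_eq_const hlam s.coe_nonneg,
        ShockSystem.cumul_of_eq_const hlam (add_nonneg s.coe_nonneg u.coe_nonneg)]
      ring
    · obtain ⟨v, h1, h2, h3⟩ :=
        ShockSystem.exists_timeChange hS.lam_nonneg hS.lam_integrable hsup s
      exact ⟨v, h1, h2, h3, Or.inr hq⟩
  have hq : ∀ u, 0 ≤ u → q (s + u) ≤ q u := by
    intro u hu
    have hsu : 0 ≤ (s : ℝ) + u := add_nonneg s.coe_nonneg hu
    rcases hcase with ⟨hanti, -⟩ | ⟨⟨c, hc⟩, -⟩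
    · exact hanti hu hsu (by linarith [s.coe_nonneg])
    · rw [hc _ hu, hc _ hsu]
  have hexp : ENNReal.ofReal (Real.exp (-ShockSystem.cumul h (s + t : ℝ≥0))) ≤
      ENNReal.ofReal (Real.exp (-ShockSystem.cumul h s)) *
        ENNReal.ofReal (Real.exp (-ShockSystem.cumul h t)) := by
    rw [← ENNReal.ofReal_mul (Real.exp_nonneg _), NNReal.coe_add]
    exact ENNReal.ofReal_le_ofReal (hh s t s.coe_nonneg t.coe_nonneg)
  have hmean : ∫⁻ ω, S.meanSurvival P q L (s + t) (fun n ↦ S.T n ω) ∂P ≤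
      (∫⁻ ω, S.meanSurvival P q L s (fun n ↦ S.T n ω) ∂P) *
        ∫⁻ ω, S.meanSurvival P q L t (fun n ↦ S.T n ω) ∂P := by
    -- After replacing the original shocks by the shifted ones, both factorizations are undone,
    -- leaving a pathwise inequality.
    refine le_trans ?_ (mul_le_mul_right (hS.lintegral_meanSurvival_shift_le s t hv hle hc hqv) _)
    rw [← hS.lintegral_meanSurvival_mul, ← hS.lintegral_survival_mul, ← hS.lintegral_survival]
    refine lintegral_mono_ae ?_
    filter_upwards [hS.poisson.ae_isPointSeq, hS.ae_V_nonneg] with ω hω hV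
    rw [NNReal.coe_add]
    exact ShockSystem.survival_add_le t.coe_nonneg hω hV hq
      fun a b ha hb ↦ hS.reserve_add_le hG s t ha hb
  rw [← ENNReal.coe_add, hS.measure_lt_τ, hS.measure_lt_τ, hS.measure_lt_τ]
  refine (mul_le_mul' hexp hmean).trans (le_of_eq ?_)
  ring
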